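/- **Proposition 3.4.** Let $Q(x)=\sum_{k=0}^m q_kx^k$ be a real polynomial of degree $m\ge 1$ with $q_m>0$. For an integer $n\ge 1$, a real number $\beta_n>0$ is called an MRS number if $$\frac1{2\pi}\int_0^{\beta_n}Q'(x)\sqrt{\frac{x}{\beta_n-x}}\,dx=n .$$ Given such a $\beta_n$, put $V_n(x)=\frac1nQ(\beta_nx)$ and let $h_n$ be the real polynomial determined by $$h_n(z)=\frac1{2\pi i}\oint_{\Gamma_z}\frac{y^{1/2}}{(y-1)^{1/2}}\,V_n'(y)\,\frac{dy}{y-z},\qquad z\in\mathbb C\setminus[0,1],$$ with principal branches, where $\Gamma_z$ is any positively oriented circle centred at $0$ having $[0,1]$ and $z$ in its interior. Let $$\hat\psi_n(x)=\frac1{2\pi}\sqrt{\frac{1-x}{x}}\;h_n(x)\,\chi_{(0,1]}(x),\qquad x\in\mathbb R.$$ (a) There are $n_2\in\mathbb N$ and $h_0>0$ such that for every $n\ge n_2$ there is exactly one MRS number $\beta_n>0$, the polynomial $h_n$ exists, and $h_n(x)>h_0$ for all $x\in[0,\infty)$. (b) Let $n\ge1$ and let $\beta_n>0$ be an MRS number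 for which $h_n$ exists and $h_n(x)>0$ for all $x\in[0,\infty)$ (by (a), this covers every $n\ge \max(n_2,1)$). Then $\hat\psi_n$ is non-negative and integrable, $$\int_0^1\hat\psi_n(y)\,dy=1,$$ the function $y\mapsto\log|x-y|\,\hat\psi_n(y)$ is integrable for every $x\in[0,\infty)$, and there is a constant $\ell_n\in\mathbb R$ with $$2\int\log|x-y|\,\hat\psi_n(y)\,dy-V_n(x)-\ell_n=0\quad\text{for }x\in[0,1],$$ $$2\int\log|x-y|\,\hat\psi_n(y)\,dy-V_n(x)-\ell_n<0\quad\text{for }x\in(1,\infty).$$ Moreover, $d\mu_n(x)=\hat\psi_n(x)\,dx$ is the equilibrium measure of $[0,\infty)$ in the external field $V_n$: it is the unique minimizer, among all Borel probability measures $\mu$ on $[0,\infty)$, of $$\iint\log\frac1{|s-t|}\,d\mu(s)\,d\mu(t)+\int V_n(t)\,d\mu(t),$$ read as $\iint\bigl(\log\frac1{|s-t|}+\tfrac12V_n(s)+\tfrac12V_n(t)\bigr)d\mu(s)\,d\mu(t)\in(-\infty,+\infty]$, where the integrand is $+\infty$ for $s=t$. -/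

import Mathlib

open Polynomial MeasureTheory

/-- `β` is a Mhaskar-Rakhmanov-Saff number of index `n` for the field `Q` on `[0, ∞)`:
`β > 0` and `(1 / 2π) ∫_0^β Q'(x) √(x / (β - x)) dx = n`. -/
def IsMRSNumber (Q : ℝ[X]) (n : ℕ) (β : ℝ) : Prop :=
  0 < β ∧
    (1 / (2 * Real.pi)) * ∫ x in (0 : ℝ)..β,
      Q.derivative.eval x * Real.sqrt (x / (β - x)) = (n : ℝ)

/-- The rescaled field `V(x) = Q(β x) / n`, as a polynomial in `x`. -/
noncomputable def rescaledField (Q : ℝ[X]) (n : ℕ) (β : ℝ) : ℝ[X] :=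
  C (1 / (n : ℝ)) * Q.comp (C β * X)

/-- `h` is the real polynomial which on `ℂ \ [0, 1]` is given by the contour integral
`h(z) = (1 / 2πi) ∮ y^{1/2} / (y - 1)^{1/2} V'(y) dy / (y - z)`,
with principal branches, over every positively oriented circle centred at the origin that has
both `[0, 1]` and `z` in its interior. (A polynomial is determined by its values
on `ℂ \ [0, 1]`, so there is at most one such `h`.) -/
def IsDensityPolynomial (V h : ℝ[X]) : Prop :=
  ∀ z : ℂ, z ∉ ((fun x : ℝ => (x : ℂ)) '' Set.Icc (0 : ℝ) 1) →
    ∀ R : ℝ, 1 < R → ‖z‖ < R →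
      aeval z h = (1 / (2 * (Real.pi : ℂ) * Complex.I)) *
        ∮ y in C((0 : ℂ), R),
          y ^ (1 / 2 : ℂ) / (y - 1) ^ (1 / 2 : ℂ) * aeval y V.derivative * (1 / (y - z))

/-- The density `(1 / 2π) √((1 - x) / x) h(x)` on `(0, 1]`, extended by zero to `ℝ`. -/
noncomputable def equilibriumDensity (h : ℝ[X]) : ℝ → ℝ :=
  (Set.Ioc (0 : ℝ) 1).indicator fun x =>
    (1 / (2 * Real.pi)) * Real.sqrt ((1 - x) / x) * h.eval x

/-- The integrand `log (1 / |s - t|) + (V(s) + V(t)) / 2` of the weighted logarithmic energy,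
equal to `+∞` on the diagonal. -/
noncomputable def energyKernel (V : ℝ → ℝ) (s t : ℝ) : EReal :=
  open Classical in
  if s = t then ⊤ else ((Real.log (1 / |s - t|) + (V s + V t) / 2 : ℝ) : EReal)

/-- The energy `∬ log (1 / |s - t|) dμ(s) dμ(t) + ∫ V dμ` of a probability measure `μ` in the
external field `V`, read in the usual way as the single double integral
`∬ (log (1 / |s - t|) + (V(s) + V(t)) / 2) dμ(s) dμ(t)`. If `V` grows faster than
`2 log |t|` at infinity, the integrand is bounded below on the support of `μ`, the integral of
the negative part is finite, and the energy is a well-defined element of `(-∞, +∞]`. -/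
noncomputable def weightedEnergy (V : ℝ → ℝ) (μ : Measure ℝ) : EReal :=
  ((∫⁻ p, (energyKernel V p.1 p.2).toENNReal ∂(μ.prod μ) : ENNReal) : EReal) -
    ((∫⁻ p, (-energyKernel V p.1 p.2).toENNReal ∂(μ.prod μ) : ENNReal) : EReal)

/-- `μ` is the equilibrium measure of `S` in the external field `V`: the unique minimizer of the
weighted energy among all Borel probability measures on `S`. -/
def IsEquilibriumMeasure (S : Set ℝ) (V : ℝ → ℝ) (μ : Measure ℝ) : Prop :=
  IsProbabilityMeasure μ ∧ μ Sᶜ = 0 ∧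
    ∀ ν : Measure ℝ, IsProbabilityMeasure ν → ν Sᶜ = 0 → ν ≠ μ →
      weightedEnergy V μ < weightedEnergy V ν

/-! Everything becomes explicit under `x = (1 + cos θ) / 2`. The quotient `y^{1/2} / (y - 1)^{1/2}`
is the average of `y / (y - s)` over the arcsine law on `[0, 1]`. By Cauchy's formula, `h` is
therefore the arcsine average of the divided differences of `W(y) = y V'(y)`
(`contour_eq_divided_difference`), hence a polynomial. With `V = ∑ b_k T_k(2x - 1)` this gives `(x -
1) h(x) = ∑ k b_k T_k(2x - 1) - c` (`sub_one_mul_arcDividedDifference`), where `c` is the arcsine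
mean of `W`. The MRS condition says exactly that `c = 2`.

In the angle, `ψ dx` becomes `(1 / 2π)(2 - ∑ k b_k cos kθ) dθ`, which has mass one. Writing `x = (2
+ w + w⁻¹) / 4` with `|w| ≥ 1`, the integral over `[0, π]` of `log |x - (1 + cos θ) / 2| cos kθ` is
`-π Re(w^{-k}) / k`, so the potential is a finite sum. For `|w| = 1` it reproduces `V / 2` up to a
constant. For `w = e^t`, `t > 0`, the variational expression is `2t - ∑ b_k sinh kt`, which vanishes
at `t = 0` and has derivative `-(x - 1) h(x) < 0`.

The variational conditions imply strict minimality because the logarithmic energy is positive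
definite on differences of probability measures (`logEnergy_sub_pos`): `-log |x|` is an integral
over `a` of Cauchy kernels minus constants, and each Cauchy kernel has a positive Fourier transform.

For (a), the MRS equation is polynomial in `β` with positive leading coefficient, so each large `n`
has exactly one root, and that root is large. For large `β` the top-degree term of `h` dominates the
others uniformly in `x ≥ 0` (`arcDividedDifference_lower_bound`). -/

/-! ### Positive definiteness of the logarithmic energy -/

/-- The integrand of the representation `-log |x| = ∫₀^∞ (a / (x² + a²) - a / (1 + a²)) da`. -/
noncomputable def logKernel (x a : ℝ) : ℝ := a / (x ^ 2 + a ^ 2) - a / (1 + a ^ 2)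

lemma logKernel_nonneg {x a : ℝ} (hx : x ^ 2 ≤ 1) (ha : 0 < a) : 0 ≤ logKernel x a := by
  unfold logKernel
  rw [sub_nonneg]
  gcongr

lemma logKernel_nonpos {x a : ℝ} (hx : 1 ≤ x ^ 2) (ha : 0 < a) : logKernel x a ≤ 0 := by
  unfold logKernel
  rw [sub_nonpos]
  gcongr

lemma hasDerivAt_logKernel_primitive {x : ℝ} (hx : x ≠ 0) (a : ℝ) :
    HasDerivAt (fun a : ℝ => (1 / 2) * (Real.log (x ^ 2 + a ^ 2) - Real.log (1 + a ^ 2)))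
      (logKernel x a) a := by
  have h1 : (x ^ 2 + a ^ 2) ≠ 0 := by positivity
  have h2 : (1 + a ^ 2) ≠ 0 := by positivity
  have h3 := ((((hasDerivAt_pow 2 a).const_add (x ^ 2)).log h1).sub
    (((hasDerivAt_pow 2 a).const_add 1).log h2)).const_mul (1 / 2)
  refine h3.congr_deriv ?_
  unfold logKernel
  field_simp
  simp

lemma tendsto_logKernel_primitive (x : ℝ) (hx : x ≠ 0) :
    Filter.Tendsto (fun a : ℝ => (1 / 2) * (Real.log (x ^ 2 + a ^ 2) - Real.log (1 + a ^ 2)))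
      Filter.atTop (nhds 0) := by
  have h : Filter.Tendsto (fun a : ℝ => 1 + (x ^ 2 - 1) / (1 + a ^ 2)) Filter.atTop
      (nhds (1 + 0)) := by
    refine tendsto_const_nhds.add (Filter.Tendsto.div_atTop tendsto_const_nhds ?_)
    exact Filter.tendsto_atTop_add_const_left _ _ (Filter.tendsto_pow_atTop two_ne_zero)
  have h2 := ((Real.continuousAt_log (x := 1 + 0) (by norm_num)).tendsto.comp h).const_mul (1 / 2)
  simp only [add_zero, Real.log_one, mul_zero] at h2
  refine h2.congr fun a => ?_
  have h1 : (x ^ 2 + a ^ 2) ≠ 0 := by positivity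
  have h2 : (1 + a ^ 2) ≠ 0 := by positivity
  rw [← Real.log_div h1 h2, Function.comp_apply]
  congr 2
  field_simp
  ring

lemma logKernel_primitive_zero (x : ℝ) :
    (1 / 2) * (Real.log (x ^ 2 + 0 ^ 2) - Real.log (1 + 0 ^ 2)) = Real.log |x| := by
  simp [Real.log_pow]

lemma integrableOn_logKernel {x : ℝ} (hx : x ≠ 0) :
    IntegrableOn (logKernel x) (Set.Ioi 0) := by
  rcases le_total (x ^ 2) 1 with h | h
  · exact integrableOn_Ioi_deriv_of_nonneg'
      (fun a _ => hasDerivAt_logKernel_primitive hx a)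
      (fun a ha => logKernel_nonneg h ha) (tendsto_logKernel_primitive x hx)
  · exact integrableOn_Ioi_deriv_of_nonpos'
      (fun a _ => hasDerivAt_logKernel_primitive hx a)
      (fun a ha => logKernel_nonpos h ha) (tendsto_logKernel_primitive x hx)

lemma integral_logKernel {x : ℝ} (hx : x ≠ 0) :
    ∫ a in Set.Ioi 0, logKernel x a = -Real.log |x| := by
  rw [integral_Ioi_of_hasDerivAt_of_tendsto'
    (fun a _ => hasDerivAt_logKernel_primitive hx a) (integrableOn_logKernel hx)
    (tendsto_logKernel_primitive x hx), logKernel_primitive_zero, zero_sub]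

/-- For fixed `x` the kernel has one sign for all `a > 0`, decided by whether `|x| ≤ 1`. Absolute
integrability over `a` and `p` thus reduces to that of `log |p.1 - p.2|`, which licenses Fubini. -/
lemma integral_norm_logKernel {x : ℝ} (hx : x ≠ 0) :
    ∫ a in Set.Ioi 0, ‖logKernel x a‖ = |Real.log (|x|)| := by
  rcases le_total (x ^ 2) 1 with h | h
  · rw [setIntegral_congr_fun (g := logKernel x) measurableSet_Ioi
      (fun a ha => by simp [abs_of_nonneg (logKernel_nonneg h ha)]), integral_logKernel hx,
      abs_of_nonpos (Real.log_nonpos (abs_nonneg x) ((sq_le_one_iff_abs_le_one x).1 h))]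
  · rw [setIntegral_congr_fun (g := fun a => -logKernel x a) measurableSet_Ioi
      (fun a ha => by simp [abs_of_nonpos (logKernel_nonpos h ha)]), integral_neg,
      integral_logKernel hx, neg_neg,
      abs_of_nonneg (Real.log_nonneg ((one_le_sq_iff_one_le_abs x).1 h))]

lemma measurable_logKernel_uncurry :
    Measurable (fun q : (ℝ × ℝ) × ℝ => logKernel (q.1.1 - q.1.2) q.2) := by
  unfold logKernel
  fun_prop

lemma ae_fst_ne_snd {ρ : Measure (ℝ × ℝ)} (hd : ρ {p | p.1 = p.2} = 0) :
    ∀ᵐ p ∂ρ, p.1 - p.2 ≠ 0 := by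
  rw [ae_iff]
  simpa [sub_eq_zero] using hd

lemma integrable_logKernel_prod {ρ : Measure (ℝ × ℝ)} [IsFiniteMeasure ρ]
    (hd : ρ {p | p.1 = p.2} = 0) (hi : Integrable (fun p => Real.log |p.1 - p.2|) ρ) :
    Integrable (fun q : (ℝ × ℝ) × ℝ => logKernel (q.1.1 - q.1.2) q.2)
      (ρ.prod (volume.restrict (Set.Ioi 0))) := by
  rw [integrable_prod_iff measurable_logKernel_uncurry.aestronglyMeasurable]
  constructor
  · filter_upwards [ae_fst_ne_snd hd] with p hp using integrableOn_logKernel hp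
  · refine hi.abs.congr ?_
    filter_upwards [ae_fst_ne_snd hd] with p hp
    exact (integral_norm_logKernel hp).symm

lemma neg_integral_log_eq {ρ : Measure (ℝ × ℝ)} [IsFiniteMeasure ρ]
    (hd : ρ {p | p.1 = p.2} = 0) (hi : Integrable (fun p => Real.log |p.1 - p.2|) ρ) :
    -∫ p, Real.log |p.1 - p.2| ∂ρ =
      ∫ a in Set.Ioi (0 : ℝ), ∫ p, logKernel (p.1 - p.2) a ∂ρ := by
  rw [← integral_integral_swap (integrable_logKernel_prod hd hi), ← integral_neg]
  refine integral_congr_ae ?_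
  filter_upwards [ae_fst_ne_snd hd] with p hp
  exact (integral_logKernel hp).symm

lemma cauchyKernel_le {a : ℝ} (ha : 0 < a) (x : ℝ) : ‖a / (x ^ 2 + a ^ 2)‖ ≤ a / a ^ 2 := by
  rw [Real.norm_of_nonneg (by positivity)]
  gcongr
  nlinarith [sq_nonneg x]

lemma integrable_cauchyKernel (ρ : Measure (ℝ × ℝ)) [IsFiniteMeasure ρ] {a : ℝ} (ha : 0 < a) :
    Integrable (fun p : ℝ × ℝ => a / ((p.1 - p.2) ^ 2 + a ^ 2)) ρ :=
  Integrable.of_bound (Measurable.aestronglyMeasurable (by fun_prop)) _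
    (Filter.Eventually.of_forall fun p => cauchyKernel_le ha (p.1 - p.2))

lemma integral_logKernel_eq_cauchy (ρ : Measure (ℝ × ℝ)) [IsProbabilityMeasure ρ] {a : ℝ}
    (ha : 0 < a) : ∫ p, logKernel (p.1 - p.2) a ∂ρ =
      (∫ p, a / ((p.1 - p.2) ^ 2 + a ^ 2) ∂ρ) - a / (1 + a ^ 2) := by
  unfold logKernel
  rw [integral_sub (integrable_cauchyKernel ρ ha) (integrable_const _)]
  simp

lemma integral_exp_neg_mul_charFun_kernel {a : ℝ} (ha : 0 < a) (x : ℝ) :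
    (∫ ξ in Set.Ioi (0 : ℝ), Complex.exp ((-a + x * Complex.I) * ξ)).re = a / (x ^ 2 + a ^ 2) := by
  rw [integral_exp_mul_complex_Ioi (by simpa using ha)]
  simp [Complex.div_re, Complex.normSq_apply]
  ring

lemma integrable_exp_prod (ρ : Measure (ℝ × ℝ)) [IsFiniteMeasure ρ] {a : ℝ} (ha : 0 < a) :
    Integrable (fun q : (ℝ × ℝ) × ℝ =>
      Complex.exp ((-a + ((q.1.1 - q.1.2 : ℝ) : ℂ) * Complex.I) * q.2))
      (ρ.prod (volume.restrict (Set.Ioi 0))) := by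
  have h : IntegrableOn (fun ξ : ℝ => Real.exp (-a * ξ)) (Set.Ioi 0) :=
    integrableOn_exp_mul_Ioi (by linarith) 0
  refine ((integrable_const (1 : ℝ) (μ := ρ)).mul_prod h).mono' ?_ ?_
  · exact Measurable.aestronglyMeasurable (by fun_prop)
  · refine Filter.Eventually.of_forall fun q => ?_
    rw [Complex.norm_exp]
    simp

lemma charFun_mul_conj_eq (μ ν : Measure ℝ) [IsFiniteMeasure μ] [IsFiniteMeasure ν]
    (a ξ : ℝ) : ∫ p, Complex.exp ((-a + ((p.1 - p.2 : ℝ) : ℂ) * Complex.I) * ξ) ∂(μ.prod ν) =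
      Real.exp (-a * ξ) * (charFun μ ξ * (starRingEnd ℂ) (charFun ν ξ)) := by
  have h : ∀ p : ℝ × ℝ, Complex.exp ((-a + ((p.1 - p.2 : ℝ) : ℂ) * Complex.I) * ξ) =
      Real.exp (-a * ξ) * (Complex.exp (ξ * p.1 * Complex.I) *
        (starRingEnd ℂ) (Complex.exp (ξ * p.2 * Complex.I))) := by
    intro p
    rw [← Complex.exp_conj]
    push_cast
    rw [← Complex.exp_add, ← Complex.exp_add]
    congr 1
    simp
    ring
  simp_rw [h]
  rw [integral_const_mul, integral_prod_mul (fun x : ℝ => Complex.exp (ξ * x * Complex.I))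
    (fun y : ℝ => (starRingEnd ℂ) (Complex.exp (ξ * y * Complex.I))), charFun_apply_real,
    charFun_apply_real, integral_conj]

/-- The Cauchy kernel is the real part of a Laplace integral of `e^{ixξ}` over `ξ > 0`; the damping
`e^{-aξ}` justifies Fubini, and the integral over `μ × ν` factors into characteristic functions. -/
lemma integral_cauchyKernel_eq_charFun (μ ν : Measure ℝ) [IsFiniteMeasure μ] [IsFiniteMeasure ν]
    {a : ℝ} (ha : 0 < a) :
    ∫ p, a / ((p.1 - p.2) ^ 2 + a ^ 2) ∂(μ.prod ν) =
      ∫ ξ in Set.Ioi (0 : ℝ), Real.exp (-a * ξ) *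
        (charFun μ ξ * (starRingEnd ℂ) (charFun ν ξ)).re := by
  have h := integrable_exp_prod (μ.prod ν) ha
  have hsw := integral_integral_swap (f := fun (p : ℝ × ℝ) (ξ : ℝ) =>
    Complex.exp ((-a + ((p.1 - p.2 : ℝ) : ℂ) * Complex.I) * ξ)) h
  simp_rw [charFun_mul_conj_eq] at hsw
  have h1 := congrArg Complex.re hsw
  have hi2 := h.integral_prod_right
  simp_rw [charFun_mul_conj_eq] at hi2
  have e1 := integral_re (𝕜 := ℂ) h.integral_prod_left
  have e2 := integral_re (𝕜 := ℂ) hi2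
  simp only [RCLike.re_eq_complex_re] at e1 e2
  rw [← e1, ← e2] at h1
  simp_rw [integral_exp_neg_mul_charFun_kernel ha] at h1
  rw [h1]
  refine integral_congr_ae (Filter.Eventually.of_forall fun ξ => ?_)
  simp only [Complex.re_ofReal_mul]

lemma integrableOn_exp_mul_charFun (μ ν : Measure ℝ) [IsProbabilityMeasure μ]
    [IsProbabilityMeasure ν] {a : ℝ} (ha : 0 < a) :
    IntegrableOn (fun ξ => Real.exp (-a * ξ) *
        (charFun μ ξ * (starRingEnd ℂ) (charFun ν ξ)).re) (Set.Ioi 0) := by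
  have h : IntegrableOn (fun ξ : ℝ => Real.exp (-a * ξ)) (Set.Ioi 0) :=
    integrableOn_exp_mul_Ioi (by linarith) 0
  refine h.mono' ?_ ?_
  · refine Continuous.aestronglyMeasurable ?_
    have h1 : Continuous (charFun μ) := continuous_charFun
    have h2 : Continuous (charFun ν) := continuous_charFun
    have := Complex.continuous_conj
    have := Complex.continuous_re
    fun_prop
  · refine Filter.Eventually.of_forall fun ξ => ?_
    rw [norm_mul, Real.norm_of_nonneg (Real.exp_pos _).le]
    refine mul_le_of_le_one_right (Real.exp_pos _).le ?_
    refine (Complex.abs_re_le_norm _).trans ?_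
    rw [norm_mul, RCLike.norm_conj]
    exact mul_le_one₀ (norm_charFun_le_one _) (norm_nonneg _) (norm_charFun_le_one _)

lemma integral_sub_two_mul_add {α : Type*} [MeasurableSpace α] {μ : Measure α} {f g h : α → ℝ}
    (hf : Integrable f μ) (hg : Integrable g μ) (hh : Integrable h μ) :
    ∫ x, (f x - 2 * g x + h x) ∂μ = (∫ x, f x ∂μ) - 2 * (∫ x, g x ∂μ) + ∫ x, h x ∂μ := by
  have h1 : Integrable (fun x => f x - 2 * g x) μ := hf.sub (hg.const_mul 2)
  rw [integral_add h1 hh, integral_sub hf (hg.const_mul 2), integral_const_mul]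

/-- The Cauchy kernel energy of `μ - ν`, as an integral over the Fourier side. -/
lemma cauchyEnergy_sub_eq (μ ν : Measure ℝ) [IsProbabilityMeasure μ] [IsProbabilityMeasure ν]
    {a : ℝ} (ha : 0 < a) :
    (∫ p, logKernel (p.1 - p.2) a ∂(μ.prod μ)) - 2 * (∫ p, logKernel (p.1 - p.2) a ∂(μ.prod ν))
      + (∫ p, logKernel (p.1 - p.2) a ∂(ν.prod ν)) =
    ∫ ξ in Set.Ioi (0 : ℝ), Real.exp (-a * ξ) * Complex.normSq (charFun μ ξ - charFun ν ξ) := by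
  -- The constant `a / (1 + a ^ 2)` occurs with weights `1, -2, 1` and cancels, because both
  -- measures have mass one.
  rw [integral_logKernel_eq_cauchy _ ha, integral_logKernel_eq_cauchy _ ha,
    integral_logKernel_eq_cauchy _ ha, integral_cauchyKernel_eq_charFun _ _ ha,
    integral_cauchyKernel_eq_charFun _ _ ha, integral_cauchyKernel_eq_charFun _ _ ha]
  have i1 := integrableOn_exp_mul_charFun μ μ ha
  have i2 := integrableOn_exp_mul_charFun μ ν ha
  have i3 := integrableOn_exp_mul_charFun ν ν ha
  have e : ∀ ξ : ℝ, Real.exp (-a * ξ) * Complex.normSq (charFun μ ξ - charFun ν ξ) =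
      Real.exp (-a * ξ) * (charFun μ ξ * (starRingEnd ℂ) (charFun μ ξ)).re
      - 2 * (Real.exp (-a * ξ) * (charFun μ ξ * (starRingEnd ℂ) (charFun ν ξ)).re)
      + Real.exp (-a * ξ) * (charFun ν ξ * (starRingEnd ℂ) (charFun ν ξ)).re := by
    intro ξ
    simp [Complex.normSq_apply]
    ring
  simp_rw [e]
  rw [integral_sub_two_mul_add i1 i2 i3]
  ring

/-- One value of `a` suffices: a continuous nonnegative integrand with zero integral vanishes for
all `ξ > 0`, and conjugation symmetry of characteristic functions covers `ξ < 0`. -/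
lemma eq_of_cauchyEnergy_sub_eq_zero (μ ν : Measure ℝ) [IsProbabilityMeasure μ]
    [IsProbabilityMeasure ν] {a : ℝ} (ha : 0 < a)
    (h : ∫ ξ in Set.Ioi (0 : ℝ),
      Real.exp (-a * ξ) * Complex.normSq (charFun μ ξ - charFun ν ξ) = 0) : μ = ν := by
  have hμ : Continuous (charFun μ) := continuous_charFun
  have hν : Continuous (charFun ν) := continuous_charFun
  have hc : Continuous fun ξ : ℝ =>
      Real.exp (-a * ξ) * Complex.normSq (charFun μ ξ - charFun ν ξ) := by
    have := Complex.continuous_normSq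
    fun_prop
  have hi : IntegrableOn (fun ξ : ℝ =>
      Real.exp (-a * ξ) * Complex.normSq (charFun μ ξ - charFun ν ξ)) (Set.Ioi 0) := by
    have h0 : IntegrableOn (fun ξ : ℝ => Real.exp (-a * ξ)) (Set.Ioi 0) :=
      integrableOn_exp_mul_Ioi (by linarith) 0
    refine (h0.mul_const 4).mono' hc.aestronglyMeasurable
      (Filter.Eventually.of_forall fun ξ => ?_)
    rw [Real.norm_of_nonneg (mul_nonneg (Real.exp_pos _).le (Complex.normSq_nonneg _))]
    refine mul_le_mul_of_nonneg_left ?_ (Real.exp_pos _).le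
    rw [Complex.normSq_eq_norm_sq]
    have h1 := norm_sub_le (charFun μ ξ) (charFun ν ξ)
    have h2 := norm_charFun_le_one (μ := μ) ξ
    have h3 := norm_charFun_le_one (μ := ν) ξ
    nlinarith [norm_nonneg (charFun μ ξ - charFun ν ξ)]
  have hz := (integral_eq_zero_iff_of_nonneg
    (fun ξ => mul_nonneg (Real.exp_pos _).le (Complex.normSq_nonneg _)) hi).1 h
  have hz' := Measure.eqOn_open_of_ae_eq hz isOpen_Ioi hc.continuousOn continuousOn_const
  have hpos : ∀ ξ : ℝ, 0 < ξ → charFun μ ξ = charFun ν ξ := by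
    intro ξ hξ
    have h1 := hz' hξ
    simp only [Pi.zero_apply, mul_eq_zero, (Real.exp_pos _).ne', false_or,
      Complex.normSq_eq_zero, sub_eq_zero] at h1
    exact h1
  apply Measure.ext_of_charFun
  ext ξ
  rcases lt_trichotomy ξ 0 with hξ | hξ | hξ
  · have h1 := hpos (-ξ) (by linarith)
    rw [charFun_neg, charFun_neg] at h1
    exact (starRingEnd ℂ).injective h1
  · simp [hξ]
  · exact hpos ξ hξ

/-- The logarithmic energy is positive definite on differences of probability measures. -/
theorem logEnergy_sub_pos (μ ν : Measure ℝ) [IsProbabilityMeasure μ] [IsProbabilityMeasure ν]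
    (hne : μ ≠ ν)
    (hd1 : (μ.prod μ) {p | p.1 = p.2} = 0) (hd2 : (μ.prod ν) {p | p.1 = p.2} = 0)
    (hd3 : (ν.prod ν) {p | p.1 = p.2} = 0)
    (hi1 : Integrable (fun p : ℝ × ℝ => Real.log |p.1 - p.2|) (μ.prod μ))
    (hi2 : Integrable (fun p : ℝ × ℝ => Real.log |p.1 - p.2|) (μ.prod ν))
    (hi3 : Integrable (fun p : ℝ × ℝ => Real.log |p.1 - p.2|) (ν.prod ν)) :
    0 < -(∫ p, Real.log |p.1 - p.2| ∂(μ.prod μ)) + 2 * (∫ p, Real.log |p.1 - p.2| ∂(μ.prod ν))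
      - (∫ p, Real.log |p.1 - p.2| ∂(ν.prod ν)) := by
  have j1 := (integrable_logKernel_prod hd1 hi1).integral_prod_right
  have j2 := (integrable_logKernel_prod hd2 hi2).integral_prod_right
  have j3 := (integrable_logKernel_prod hd3 hi3).integral_prod_right
  have e1 := neg_integral_log_eq hd1 hi1
  have e2 := neg_integral_log_eq hd2 hi2
  have e3 := neg_integral_log_eq hd3 hi3
  have key : -(∫ p, Real.log |p.1 - p.2| ∂(μ.prod μ))
      + 2 * (∫ p, Real.log |p.1 - p.2| ∂(μ.prod ν)) - (∫ p, Real.log |p.1 - p.2| ∂(ν.prod ν)) =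
      ∫ a in Set.Ioi (0 : ℝ), ((∫ p, logKernel (p.1 - p.2) a ∂(μ.prod μ))
        - 2 * (∫ p, logKernel (p.1 - p.2) a ∂(μ.prod ν))
        + (∫ p, logKernel (p.1 - p.2) a ∂(ν.prod ν))) := by
    rw [integral_sub_two_mul_add j1 j2 j3, ← e1, ← e2, ← e3]
    ring
  have hnn : ∀ a ∈ Set.Ioi (0 : ℝ), 0 ≤ (∫ p, logKernel (p.1 - p.2) a ∂(μ.prod μ))
        - 2 * (∫ p, logKernel (p.1 - p.2) a ∂(μ.prod ν))
        + (∫ p, logKernel (p.1 - p.2) a ∂(ν.prod ν)) := by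
    intro a ha
    rw [cauchyEnergy_sub_eq μ ν ha]
    exact integral_nonneg fun ξ => mul_nonneg (Real.exp_pos _).le (Complex.normSq_nonneg _)
  rw [key]
  -- If the integral over `a` were zero, its nonnegative integrand would vanish for almost every `a
  -- > 0`, and a single such `a` already forces `μ = ν`.
  refine lt_of_le_of_ne (setIntegral_nonneg measurableSet_Ioi hnn) fun h0 => hne ?_
  have hz := (integral_eq_zero_iff_of_nonneg_ae
    ((ae_restrict_iff' measurableSet_Ioi).2 (Filter.Eventually.of_forall hnn))
    ((j1.sub (j2.const_mul 2)).add j3)).1 h0.symm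
  have hz2 := (ae_restrict_iff' measurableSet_Ioi).1 hz
  have : ∃ a : ℝ, 0 < a ∧ (∫ p, logKernel (p.1 - p.2) a ∂(μ.prod μ))
        - 2 * (∫ p, logKernel (p.1 - p.2) a ∂(μ.prod ν))
        + (∫ p, logKernel (p.1 - p.2) a ∂(ν.prod ν)) = 0 := by
    by_contra! hcon
    have h1 : ∀ᵐ a : ℝ, a ∉ Set.Ioi (0 : ℝ) := by
      filter_upwards [hz2] with a ha ha'
      exact hcon a ha' (ha ha')
    rw [ae_iff] at h1
    simp only [not_not] at h1
    change volume (Set.Ioi (0 : ℝ)) = 0 at h1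
    simp at h1
  obtain ⟨a, ha, h1⟩ := this
  rw [cauchyEnergy_sub_eq μ ν ha] at h1
  exact eq_of_cauchyEnergy_sub_eq_zero μ ν ha h1

/-! ### Variational conditions and the equilibrium measure -/

/-- The finite part of the weighted energy kernel. -/
noncomputable def realKernel (V : ℝ → ℝ) (p : ℝ × ℝ) : ℝ :=
  -Real.log |p.1 - p.2| + (V p.1 + V p.2) / 2

lemma energyKernel_of_ne {V : ℝ → ℝ} {p : ℝ × ℝ} (h : p.1 - p.2 ≠ 0) :
    energyKernel V p.1 p.2 = ((realKernel V p : ℝ) : EReal) := by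
  rw [energyKernel, if_neg (sub_ne_zero.1 h), realKernel, one_div, Real.log_inv]

/-- From `|s - t| ≤ (1 + s)(1 + t)`. The bound separates the variables, so the growth of `V` can
absorb it. -/
lemma log_abs_sub_le {s t : ℝ} (hs : 0 ≤ s) (ht : 0 ≤ t) :
    Real.log |s - t| ≤ Real.log (1 + s) + Real.log (1 + t) := by
  rcases eq_or_ne (s - t) 0 with h | h
  · rw [h, abs_zero, Real.log_zero]
    exact add_nonneg (Real.log_nonneg (by linarith)) (Real.log_nonneg (by linarith))
  · rw [← Real.log_mul (by positivity) (by positivity)]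
    refine Real.log_le_log (abs_pos.2 h) ?_
    rw [abs_le]
    constructor <;> nlinarith [mul_nonneg hs ht]

/-- The factor 4 in `hV` spends only half of the available `V / 2` on the logarithm. The quarter of
`V` that remains lets finite energy force `V` to be integrable. -/
lemma realKernel_ge {V : ℝ → ℝ} {C : ℝ} (hV : ∀ t, 0 ≤ t → 4 * Real.log (1 + t) ≤ V t + C)
    {p : ℝ × ℝ} (h1 : 0 ≤ p.1) (h2 : 0 ≤ p.2) :
    (V p.1 + C) / 4 + (V p.2 + C) / 4 ≤ realKernel V p + C := by
  have := log_abs_sub_le h1 h2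
  have := hV _ h1
  have := hV _ h2
  unfold realKernel
  linarith

lemma field_add_const_nonneg {V : ℝ → ℝ} {C : ℝ}
    (hV : ∀ t, 0 ≤ t → 4 * Real.log (1 + t) ≤ V t + C) {t : ℝ} (ht : 0 ≤ t) : 0 ≤ V t + C :=
  le_trans (mul_nonneg (by norm_num) (Real.log_nonneg (by linarith))) (hV t ht)

lemma ae_nonneg_of_compl_null {ν : Measure ℝ} (hν : ν (Set.Ici 0)ᶜ = 0) : ∀ᵐ s ∂ν, 0 ≤ s := by
  rw [ae_iff]
  exact hν

lemma ae_nonneg_prod {μ ν : Measure ℝ} [SFinite μ] [SFinite ν] (hμ : μ (Set.Ici 0)ᶜ = 0)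
    (hν : ν (Set.Ici 0)ᶜ = 0) :
    ∀ᵐ p ∂(μ.prod ν), 0 ≤ p.1 ∧ 0 ≤ p.2 := by
  filter_upwards [Measure.quasiMeasurePreserving_fst.ae (ae_nonneg_of_compl_null hμ),
    Measure.quasiMeasurePreserving_snd.ae (ae_nonneg_of_compl_null hν)] with p h1 h2
  exact ⟨h1, h2⟩

lemma measurable_realKernel {V : ℝ → ℝ} (hV : Continuous V) : Measurable (realKernel V) := by
  have := hV.measurable
  unfold realKernel
  fun_prop

lemma lintegral_neg_energyKernel_ne_top {V : ℝ → ℝ} {C : ℝ}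
    (hV : ∀ t, 0 ≤ t → 4 * Real.log (1 + t) ≤ V t + C) (ν : Measure ℝ) [IsProbabilityMeasure ν]
    (hν : ν (Set.Ici 0)ᶜ = 0) :
    ∫⁻ p, (-energyKernel V p.1 p.2).toENNReal ∂(ν.prod ν) ≠ ⊤ := by
  have hle : ∫⁻ p, (-energyKernel V p.1 p.2).toENNReal ∂(ν.prod ν) ≤
      ∫⁻ _, ENNReal.ofReal C ∂(ν.prod ν) := by
    refine lintegral_mono_ae ?_
    filter_upwards [ae_nonneg_prod hν hν] with p hp
    by_cases h : p.1 = p.2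
    · simp [energyKernel, h]
    · rw [energyKernel_of_ne (sub_ne_zero.2 h), ← EReal.coe_neg, EReal.real_coe_toENNReal]
      refine ENNReal.ofReal_le_ofReal ?_
      have := realKernel_ge hV hp.1 hp.2
      have := field_add_const_nonneg hV hp.1
      have := field_add_const_nonneg hV hp.2
      linarith
  refine ne_top_of_le_ne_top ?_ hle
  simp

lemma weightedEnergy_eq_integral {V : ℝ → ℝ} {ν : Measure ℝ} [IsProbabilityMeasure ν]
    (hd : (ν.prod ν) {p | p.1 = p.2} = 0) (hi : Integrable (realKernel V) (ν.prod ν)) :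
    weightedEnergy V ν = ((∫ p, realKernel V p ∂(ν.prod ν) : ℝ) : EReal) := by
  have e1 : ∫⁻ p, (energyKernel V p.1 p.2).toENNReal ∂(ν.prod ν) =
      ∫⁻ p, ENNReal.ofReal (realKernel V p) ∂(ν.prod ν) := by
    refine lintegral_congr_ae ?_
    filter_upwards [ae_fst_ne_snd hd] with p hp
    rw [energyKernel_of_ne hp, EReal.real_coe_toENNReal]
  have e2 : ∫⁻ p, (-energyKernel V p.1 p.2).toENNReal ∂(ν.prod ν) =
      ∫⁻ p, ENNReal.ofReal (-realKernel V p) ∂(ν.prod ν) := by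
    refine lintegral_congr_ae ?_
    filter_upwards [ae_fst_ne_snd hd] with p hp
    rw [energyKernel_of_ne hp, ← EReal.coe_neg, EReal.real_coe_toENNReal]
  have f1 : ∫⁻ p, ENNReal.ofReal (realKernel V p) ∂(ν.prod ν) ≠ ⊤ := hi.lintegral_lt_top.ne
  have f2 : ∫⁻ p, ENNReal.ofReal (-realKernel V p) ∂(ν.prod ν) ≠ ⊤ := hi.neg.lintegral_lt_top.ne
  rw [weightedEnergy, e1, e2, integral_eq_lintegral_pos_part_sub_lintegral_neg_part hi,
    EReal.coe_sub, EReal.coe_ennreal_toReal f1, EReal.coe_ennreal_toReal f2]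

lemma measurableSet_diagonal_prod : MeasurableSet {p : ℝ × ℝ | p.1 = p.2} :=
  measurableSet_eq_fun measurable_fst measurable_snd

/-- The value `⊤` of the kernel on the diagonal is essential here: under the convention `Real.log 0
= 0` atoms would cost nothing. -/
lemma diagonal_null_of_lintegral_ne_top {V : ℝ → ℝ} {ρ : Measure (ℝ × ℝ)}
    (h : ∫⁻ p, (energyKernel V p.1 p.2).toENNReal ∂ρ ≠ ⊤) : ρ {p | p.1 = p.2} = 0 := by
  by_contra hne
  apply h
  rw [eq_top_iff]
  calc (⊤ : ENNReal) = ∫⁻ p, Set.indicator {p : ℝ × ℝ | p.1 = p.2} (fun _ => ⊤) p ∂ρ := by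
        rw [lintegral_indicator measurableSet_diagonal_prod, lintegral_const,
          Measure.restrict_apply_univ, ENNReal.top_mul hne]
    _ ≤ _ := by
        refine lintegral_mono fun p => ?_
        by_cases hp : p.1 = p.2
        · simp [energyKernel, hp]
        · simp [hp]

lemma integrable_realKernel_of_lintegral_ne_top {V : ℝ → ℝ} {C : ℝ} (hVc : Continuous V)
    (hV : ∀ t, 0 ≤ t → 4 * Real.log (1 + t) ≤ V t + C) {ν : Measure ℝ} [IsProbabilityMeasure ν]
    (hν : ν (Set.Ici 0)ᶜ = 0)
    (h : ∫⁻ p, (energyKernel V p.1 p.2).toENNReal ∂(ν.prod ν) ≠ ⊤) :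
    Integrable (realKernel V) (ν.prod ν) := by
  have hd := diagonal_null_of_lintegral_ne_top h
  have hm := measurable_realKernel hVc
  have h1 : Integrable (fun p => realKernel V p + C) (ν.prod ν) := by
    refine (lintegral_ofReal_ne_top_iff_integrable
      (hm.add_const C).aestronglyMeasurable ?_).1 ?_
    · filter_upwards [ae_nonneg_prod hν hν] with p hp
      have := realKernel_ge hV hp.1 hp.2
      have := field_add_const_nonneg hV hp.1
      have := field_add_const_nonneg hV hp.2
      simp only [Pi.zero_apply]
      linarith
    · have h2 : ∫⁻ p, ENNReal.ofReal (realKernel V p + C) ∂(ν.prod ν) ≤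
          ∫⁻ p, ((energyKernel V p.1 p.2).toENNReal + ENNReal.ofReal C) ∂(ν.prod ν) := by
        refine lintegral_mono_ae ?_
        filter_upwards [ae_fst_ne_snd hd] with p hp
        rw [energyKernel_of_ne hp, EReal.real_coe_toENNReal]
        exact ENNReal.ofReal_add_le
      refine ne_top_of_le_ne_top ?_ h2
      rw [lintegral_add_right _ measurable_const]
      simpa using h
  exact (h1.sub (integrable_const C)).congr (Filter.Eventually.of_forall fun p => by simp)

lemma integrable_field_of_realKernel {V : ℝ → ℝ} {C : ℝ} (hVc : Continuous V)
    (hV : ∀ t, 0 ≤ t → 4 * Real.log (1 + t) ≤ V t + C) {ν : Measure ℝ} [IsProbabilityMeasure ν]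
    (hν : ν (Set.Ici 0)ᶜ = 0) (h : Integrable (realKernel V) (ν.prod ν)) : Integrable V ν := by
  have h1 : Integrable (fun p : ℝ × ℝ => V p.1 + C) (ν.prod ν) := by
    refine Integrable.mono' ((h.add (integrable_const C)).const_mul 4) ?_ ?_
    · exact ((hVc.comp continuous_fst).add continuous_const).aestronglyMeasurable
    · filter_upwards [ae_nonneg_prod hν hν] with p hp
      have := realKernel_ge hV hp.1 hp.2
      have h3 := field_add_const_nonneg hV hp.1
      have := field_add_const_nonneg hV hp.2
      rw [Real.norm_of_nonneg h3]
      simp only [Pi.add_apply]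
      linarith
  have h2 := Integrable.of_comp_fst (f := fun x => V x + C) h1 (IsProbabilityMeasure.ne_zero ν)
  exact (h2.sub (integrable_const C)).congr (Filter.Eventually.of_forall fun p => by simp)

lemma integrable_field_prod {V : ℝ → ℝ} {μ ν : Measure ℝ} [IsProbabilityMeasure μ]
    [IsProbabilityMeasure ν] (hμ : Integrable V μ) (hν : Integrable V ν) :
    Integrable (fun p : ℝ × ℝ => (V p.1 + V p.2) / 2) (μ.prod ν) :=
  ((hμ.comp_fst ν).add (hν.comp_snd μ)).div_const 2

lemma integral_realKernel {V : ℝ → ℝ} {ν : Measure ℝ} [IsProbabilityMeasure ν]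
    (hV : Integrable V ν) (hl : Integrable (fun p : ℝ × ℝ => Real.log |p.1 - p.2|) (ν.prod ν)) :
    ∫ p, realKernel V p ∂(ν.prod ν) =
      -(∫ p, Real.log |p.1 - p.2| ∂(ν.prod ν)) + ∫ x, V x ∂ν := by
  have h1 : ∫ p, (V p.1 + V p.2) / 2 ∂(ν.prod ν) = ∫ x, V x ∂ν := by
    rw [integral_div, integral_add (hV.comp_fst ν) (hV.comp_snd ν), integral_fun_fst,
      integral_fun_snd]
    simp
  unfold realKernel
  have hl' : Integrable (fun p : ℝ × ℝ => -Real.log |p.1 - p.2|) (ν.prod ν) := hl.neg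
  rw [integral_add hl' (integrable_field_prod hV hV), h1, integral_neg]

/-- The variational (Euler-Lagrange) conditions on `[0, ∞)` characterize the equilibrium
measure. -/
theorem isEquilibriumMeasure_of_variational {V : ℝ → ℝ} {C B ℓ : ℝ} (hVc : Continuous V)
    (hV : ∀ t, 0 ≤ t → 4 * Real.log (1 + t) ≤ V t + C) {μ : Measure ℝ} [IsProbabilityMeasure μ]
    [NullSingletonClass μ] (hμ : μ (Set.Ici 0)ᶜ = 0) (hVμ : Integrable V μ)
    (hint : ∀ x, 0 ≤ x → Integrable (fun y => Real.log |x - y|) μ)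
    (hbd : ∀ x, 0 ≤ x → ∫ y, |Real.log (|x - y|)| ∂μ ≤ B + 2 * Real.log (1 + x))
    (hle : ∀ x, 0 ≤ x → 2 * (∫ y, Real.log |x - y| ∂μ) - V x ≤ ℓ)
    (heq : ∀ᵐ x ∂μ, 2 * (∫ y, Real.log |x - y| ∂μ) - V x = ℓ) :
    IsEquilibriumMeasure (Set.Ici 0) V μ := by
  have hmlog : Measurable fun p : ℝ × ℝ => Real.log |p.1 - p.2| := by fun_prop
  have hdiag : ∀ ν : Measure ℝ, IsProbabilityMeasure ν → (ν.prod μ) {p | p.1 = p.2} = 0 := by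
    intro ν _
    rw [Measure.measure_prod_null measurableSet_diagonal_prod]
    -- Each vertical slice of the diagonal is one point, which is null for the second factor `μ`;
    -- nothing is needed of `ν`.
    refine Filter.Eventually.of_forall fun x => ?_
    have : Prod.mk x ⁻¹' {p : ℝ × ℝ | p.1 = p.2} = {x} := by
      ext y
      simp [eq_comm]
    simp [this]
  have hcross : ∀ ν : Measure ℝ, IsProbabilityMeasure ν → ν (Set.Ici 0)ᶜ = 0 → Integrable V ν →
      Integrable (fun p : ℝ × ℝ => Real.log |p.1 - p.2|) (ν.prod μ) := by
    intro ν _ hν hVν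
    rw [integrable_prod_iff hmlog.aestronglyMeasurable]
    constructor
    · filter_upwards [ae_nonneg_of_compl_null hν] with x hx using hint x hx
    · refine Integrable.mono' (((hVν.add (integrable_const C)).const_mul (1 / 2)).add
        (integrable_const B)) ?_ ?_
      · exact hmlog.norm.stronglyMeasurable.integral_prod_right.aestronglyMeasurable
      · filter_upwards [ae_nonneg_of_compl_null hν] with x hx
        rw [Real.norm_of_nonneg (integral_nonneg fun y => norm_nonneg _)]
        have h1 := hbd x hx
        have h2 := hV x hx
        simp only [Real.norm_eq_abs, Pi.add_apply]
        linarith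
  have hμμ := hcross μ inferInstance hμ hVμ
  have hkμ : Integrable (realKernel V) (μ.prod μ) := hμμ.neg.add (integrable_field_prod hVμ hVμ)
  refine ⟨inferInstance, hμ, fun ν _ hν hne => ?_⟩
  rw [weightedEnergy_eq_integral (hdiag μ inferInstance) hkμ]
  -- A competitor of infinite energy loses at once, since its negative part is finite. Otherwise all
  -- the integrals below converge.
  by_cases htop : ∫⁻ p, (energyKernel V p.1 p.2).toENNReal ∂(ν.prod ν) = ⊤
  · rw [weightedEnergy, htop,
      ← EReal.coe_ennreal_toReal (lintegral_neg_energyKernel_ne_top hV ν hν),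
      EReal.coe_ennreal_top, EReal.top_sub_coe]
    exact EReal.coe_lt_top _
  have hdν := diagonal_null_of_lintegral_ne_top htop
  have hkν := integrable_realKernel_of_lintegral_ne_top hVc hV hν htop
  have hVν := integrable_field_of_realKernel hVc hV hν hkν
  have hνν : Integrable (fun p : ℝ × ℝ => Real.log |p.1 - p.2|) (ν.prod ν) := by
    refine ((integrable_field_prod hVν hVν).sub hkν).congr
      (Filter.Eventually.of_forall fun p => ?_)
    simp [realKernel]
  have hνμ := hcross ν inferInstance hν hVν
  -- With `L(σ, τ) = ∬ log |s - t| dσ dτ`, positivity gives `-L(ν, ν) > L(μ, μ) - 2 L(ν, μ)`.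
  -- Integrating the variational inequality against `ν` gives `2 L(ν, μ) - ∫ V dν ≤ ℓ`, with
  -- equality when `ν` is replaced by `μ`; combining the three yields the strict energy inequality.
  have hpos := logEnergy_sub_pos ν μ hne hdν (hdiag ν inferInstance) (hdiag μ inferInstance)
    hνν hνμ hμμ
  rw [weightedEnergy_eq_integral hdν hkν, EReal.coe_lt_coe_iff, integral_realKernel hVμ hμμ,
    integral_realKernel hVν hνν]
  have e1 := integral_prod _ hνμ
  have e2 := integral_prod _ hμμ
  have i1 := hνμ.integral_prod_left
  have i2 := hμμ.integral_prod_left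
  simp only at e1 e2 i1 i2
  have c1 : ∫ x, (2 * (∫ y, Real.log |x - y| ∂μ) - V x) ∂μ = ℓ := by
    rw [integral_congr_ae heq]
    simp
  have c2 : ∫ x, (2 * (∫ y, Real.log |x - y| ∂μ) - V x) ∂ν ≤ ℓ := by
    calc _ ≤ ∫ _, ℓ ∂ν := by
          refine integral_mono_ae ((i1.const_mul 2).sub hVν) (integrable_const ℓ) ?_
          filter_upwards [ae_nonneg_of_compl_null hν] with x hx using hle x hx
      _ = ℓ := by simp
  rw [integral_sub (i2.const_mul 2) hVμ, integral_const_mul] at c1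
  rw [integral_sub (i1.const_mul 2) hVν, integral_const_mul] at c2
  linarith

/-! ### Fourier coefficients of `log |1 - σ e^{iθ}|` -/

lemma integral_exp_int_mul (m : ℤ) :
    ∫ θ in (0 : ℝ)..(2 * Real.pi), Complex.exp (m * Complex.I * θ) =
      if m = 0 then 2 * (Real.pi : ℂ) else 0 := by
  split_ifs with h
  · simp [h]
  · have hm : (m : ℂ) * Complex.I ≠ 0 := by simp [h]
    rw [integral_exp_mul_complex hm]
    have : (m : ℂ) * Complex.I * ((2 * Real.pi : ℝ) : ℂ) = m * (2 * Real.pi * Complex.I) := by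
      push_cast; ring
    rw [this, Complex.exp_int_mul_two_pi_mul_I]
    simp

lemma integral_exp_pow_mul_cos (j k : ℕ) (hk : k ≠ 0) :
    ∫ θ in (0 : ℝ)..(2 * Real.pi), Complex.exp (θ * Complex.I) ^ j * (Real.cos (k * θ) : ℂ) =
      if j = k then (Real.pi : ℂ) else 0 := by
  have h : ∀ θ : ℝ, Complex.exp (θ * Complex.I) ^ j * (Real.cos (k * θ) : ℂ) =
      (1 / 2) * (Complex.exp (((j + k : ℕ) : ℤ) * Complex.I * θ) +
        Complex.exp (((j : ℤ) - k : ℤ) * Complex.I * θ)) := by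
    intro θ
    have := Complex.two_cos ((k * θ : ℝ) : ℂ)
    rw [Complex.ofReal_cos, ← Complex.exp_nat_mul]
    have h2 : Complex.cos ((k * θ : ℝ) : ℂ) = (1 / 2) * (Complex.exp (((k * θ : ℝ) : ℂ) * Complex.I)
      + Complex.exp (-((k * θ : ℝ) : ℂ) * Complex.I)) := by rw [← this]; ring
    rw [h2, mul_left_comm, mul_add, ← Complex.exp_add, ← Complex.exp_add]
    push_cast
    congr 3 <;> ring_nf
  simp_rw [h]
  rw [intervalIntegral.integral_const_mul, intervalIntegral.integral_add
    (Continuous.intervalIntegrable (by fun_prop) _ _)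
    (Continuous.intervalIntegrable (by fun_prop) _ _), integral_exp_int_mul, integral_exp_int_mul]
  have h1 : ((j + k : ℕ) : ℤ) ≠ 0 := by omega
  rw [if_neg h1]
  by_cases hjk : j = k
  · simp [hjk]
  · have : (j : ℤ) - k ≠ 0 := by omega
    simp [hjk, this]

lemma continuous_exp_mul_I : Continuous fun θ : ℝ => Complex.exp (θ * Complex.I) := by fun_prop

/-- Inside the disc the logarithm is the real part of the series `-∑ z^j / j`, dominated by a
geometric series, and orthogonality keeps only `j = k`. -/
lemma integral_log_norm_one_sub_of_lt {σ : ℂ} (hσ : ‖σ‖ < 1) {k : ℕ} (hk : k ≠ 0) :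
    ∫ θ in (0 : ℝ)..(2 * Real.pi),
      Real.log ‖1 - σ * Complex.exp (θ * Complex.I)‖ * Real.cos (k * θ) =
      -Real.pi * (σ ^ k).re / k := by
  have hz : ∀ θ : ℝ, ‖σ * Complex.exp (θ * Complex.I)‖ = ‖σ‖ := by
    intro θ
    rw [norm_mul, Complex.norm_exp_ofReal_mul_I, mul_one]
  -- Indexing from `j = 0` is harmless: that term is a division by zero, hence zero.
  let F : ℕ → ℝ → ℝ := fun j θ =>
    -((σ ^ j / j) * (Complex.exp (θ * Complex.I) ^ j * (Real.cos (k * θ) : ℂ))).re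
  have hF : ∀ j, Continuous (F j) := by
    intro j
    have := continuous_exp_mul_I
    have := Complex.continuous_re
    simp only [F]
    fun_prop
  have hs : HasSum (fun j => ∫ θ in (0 : ℝ)..(2 * Real.pi), F j θ)
      (∫ θ in (0 : ℝ)..(2 * Real.pi),
        Real.log ‖1 - σ * Complex.exp (θ * Complex.I)‖ * Real.cos (k * θ)) := by
    refine intervalIntegral.hasSum_integral_of_dominated_convergence
      (fun j _ => ‖σ‖ ^ j) (fun j => (hF j).aestronglyMeasurable) ?_ ?_ ?_ ?_
    · refine fun j => Filter.Eventually.of_forall fun θ _ => ?_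
      simp only [F]
      rw [norm_neg]
      refine (Complex.abs_re_le_norm _).trans ?_
      rw [norm_mul, norm_mul, norm_div, norm_pow, norm_pow, Complex.norm_exp_ofReal_mul_I,
        one_pow, one_mul, Complex.norm_real, RCLike.norm_natCast]
      have h1 : ‖Real.cos (k * θ)‖ ≤ 1 := Real.abs_cos_le_one _
      have h2 : ‖σ‖ ^ j / j ≤ ‖σ‖ ^ j := by
        rcases Nat.eq_zero_or_pos j with rfl | hj
        · simp
        · exact div_le_self (by positivity) (by exact_mod_cast hj)
      calc _ ≤ ‖σ‖ ^ j * 1 := by gcongr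
        _ = _ := mul_one _
    · exact Filter.Eventually.of_forall fun θ _ => summable_geometric_of_lt_one (norm_nonneg _) hσ
    · exact intervalIntegrable_const
    · refine Filter.Eventually.of_forall fun θ _ => ?_
      have h1 := (Complex.hasSum_taylorSeries_neg_log
        (z := σ * Complex.exp (θ * Complex.I)) (by rwa [hz])).mul_right (Real.cos (k * θ) : ℂ)
      have h2 := (Complex.hasSum_re h1).neg
      convert h2 using 1
      · ext j
        simp only [F]
        congr 2
        rw [mul_pow]
        ring
      · rw [Complex.re_mul_ofReal, Complex.neg_re, Complex.log_re]
        ring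
  have hI : ∀ j, ∫ θ in (0 : ℝ)..(2 * Real.pi), F j θ =
      if j = k then -Real.pi * (σ ^ k).re / k else 0 := by
    intro j
    have hc : Continuous fun θ : ℝ =>
        (σ ^ j / j) * (Complex.exp (θ * Complex.I) ^ j * (Real.cos (k * θ) : ℂ)) := by
      have := continuous_exp_mul_I
      fun_prop
    have h1 := Complex.reCLM.intervalIntegral_comp_comm
      (show IntervalIntegrable _ volume 0 (2 * Real.pi) from hc.intervalIntegrable _ _)
    simp only [Complex.reCLM_apply] at h1
    simp only [F]
    rw [intervalIntegral.integral_neg, h1, intervalIntegral.integral_const_mul,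
      integral_exp_pow_mul_cos j k hk]
    split_ifs with hjk
    · subst hjk
      rw [Complex.re_mul_ofReal]
      have : σ ^ j / j = σ ^ j / ((j : ℝ) : ℂ) := by push_cast; rfl
      rw [this, Complex.div_ofReal_re]
      ring
    · simp
  simp_rw [hI] at hs
  exact hs.unique (hasSum_ite_eq k _)

lemma integral_log_norm_one_sub_zero_of_lt {σ : ℂ} (hσ : ‖σ‖ < 1) :
    ∫ θ in (0 : ℝ)..(2 * Real.pi), Real.log ‖1 - σ * Complex.exp (θ * Complex.I)‖ = 0 := by
  have hz : ∀ θ : ℝ, ‖σ * Complex.exp (θ * Complex.I)‖ = ‖σ‖ := by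
    intro θ
    rw [norm_mul, Complex.norm_exp_ofReal_mul_I, mul_one]
  let F : ℕ → ℝ → ℝ := fun j θ => -((σ ^ j / j) * Complex.exp (θ * Complex.I) ^ j).re
  have hF : ∀ j, Continuous (F j) := by
    intro j
    have := continuous_exp_mul_I
    have := Complex.continuous_re
    simp only [F]
    fun_prop
  have hs : HasSum (fun j => ∫ θ in (0 : ℝ)..(2 * Real.pi), F j θ)
      (∫ θ in (0 : ℝ)..(2 * Real.pi), Real.log ‖1 - σ * Complex.exp (θ * Complex.I)‖) := by
    refine intervalIntegral.hasSum_integral_of_dominated_convergence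
      (fun j _ => ‖σ‖ ^ j) (fun j => (hF j).aestronglyMeasurable) ?_ ?_ ?_ ?_
    · refine fun j => Filter.Eventually.of_forall fun θ _ => ?_
      simp only [F]
      rw [norm_neg]
      refine (Complex.abs_re_le_norm _).trans ?_
      rw [norm_mul, norm_div, norm_pow, norm_pow, Complex.norm_exp_ofReal_mul_I,
        one_pow, mul_one, RCLike.norm_natCast]
      rcases Nat.eq_zero_or_pos j with rfl | hj
      · simp
      · exact div_le_self (by positivity) (by exact_mod_cast hj)
    · exact Filter.Eventually.of_forall fun θ _ => summable_geometric_of_lt_one (norm_nonneg _) hσ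
    · exact intervalIntegrable_const
    · refine Filter.Eventually.of_forall fun θ _ => ?_
      have h1 := (Complex.hasSum_taylorSeries_neg_log
        (z := σ * Complex.exp (θ * Complex.I)) (by rwa [hz]))
      have h2 := (Complex.hasSum_re h1).neg
      convert h2 using 1
      · ext j
        simp only [F]
        congr 2
        rw [mul_pow]
        ring
      · rw [Complex.neg_re, Complex.log_re]
        ring
  have hI : ∀ j, ∫ θ in (0 : ℝ)..(2 * Real.pi), F j θ = 0 := by
    intro j
    have hc : Continuous fun θ : ℝ => (σ ^ j / j) * Complex.exp (θ * Complex.I) ^ j := by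
      have := continuous_exp_mul_I
      fun_prop
    have h1 := Complex.reCLM.intervalIntegral_comp_comm
      (show IntervalIntegrable _ volume 0 (2 * Real.pi) from hc.intervalIntegrable _ _)
    simp only [Complex.reCLM_apply] at h1
    simp only [F]
    rw [intervalIntegral.integral_neg, h1, intervalIntegral.integral_const_mul]
    rcases Nat.eq_zero_or_pos j with rfl | hj
    · simp
    · have h3 : ∀ θ : ℝ, Complex.exp (θ * Complex.I) ^ j =
          Complex.exp (((j : ℤ) : ℂ) * Complex.I * θ) := by
        intro θ
        rw [← Complex.exp_nat_mul]
        push_cast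
        ring_nf
      simp_rw [h3]
      rw [integral_exp_int_mul, if_neg (by omega)]
      simp
  simp_rw [hI] at hs
  exact hs.unique hasSum_zero

lemma countable_setOf_mul_exp_eq_one (σ : ℂ) :
    {θ : ℝ | 1 - σ * Complex.exp (θ * Complex.I) = 0}.Countable := by
  rcases Set.eq_empty_or_nonempty {θ : ℝ | 1 - σ * Complex.exp (θ * Complex.I) = 0} with h | h
  · rw [h]; exact Set.countable_empty
  · obtain ⟨θ₀, h0⟩ := h
    refine (Set.countable_range fun n : ℤ => θ₀ + n * (2 * Real.pi)).mono fun θ hθ => ?_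
    simp only [Set.mem_ofPred_eq, sub_eq_zero] at h0 hθ
    have hσ : σ ≠ 0 := by rintro rfl; simp at h0
    have h1 : Complex.exp (θ * Complex.I) = Complex.exp (θ₀ * Complex.I) :=
      mul_left_cancel₀ hσ (hθ.symm.trans h0)
    obtain ⟨n, hn⟩ := Complex.exp_eq_exp_iff_exists_int.1 h1
    refine ⟨n, ?_⟩
    have h2 : (θ : ℂ) = θ₀ + n * (2 * Real.pi) :=
      mul_right_cancel₀ Complex.I_ne_zero (by rw [hn]; ring)
    simp only
    exact_mod_cast h2.symm

lemma ae_one_sub_mul_exp_ne_zero (σ : ℂ) (μ : Measure ℝ) [NullSingletonClass μ] :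
    ∀ᵐ θ : ℝ ∂μ, 1 - σ * Complex.exp (θ * Complex.I) ≠ 0 :=
  (countable_setOf_mul_exp_eq_one σ).ae_notMem μ

lemma intervalIntegrable_log_norm_one_sub (σ : ℂ) :
    IntervalIntegrable (fun θ : ℝ => Real.log ‖1 - σ * Complex.exp (θ * Complex.I)‖) volume 0
      (2 * Real.pi) := by
  have h : MeromorphicOn (fun z : ℂ => 1 - σ * z) (Metric.sphere 0 |1|) := fun z _ =>
    AnalyticAt.meromorphicAt (by fun_prop)
  have h2 := h.circleIntegrable_log_norm
  simpa [CircleIntegrable, circleMap] using h2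

/-- Both summands in `|1 - z| ≤ |1 - rz| + (1 - r)` are at most `|1 - rz|`. This keeps the
logarithmic singularity at radius `r` below the integrable one at `r = 1`, uniformly in `r`. -/
lemma norm_one_sub_le_two_mul {z : ℂ} (hz : ‖z‖ ≤ 1) {r : ℝ} (h0 : 0 ≤ r) (h1 : r ≤ 1) :
    ‖1 - z‖ ≤ 2 * ‖1 - r * z‖ := by
  have e1 : ‖1 - z‖ ≤ ‖1 - r * z‖ + (1 - r) := by
    have : (1 : ℂ) - z = (1 - r * z) + -(((1 - r : ℝ) : ℂ) * z) := by push_cast; ring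
    rw [this]
    refine (norm_add_le _ _).trans ?_
    rw [norm_neg, norm_mul, Complex.norm_real, Real.norm_of_nonneg (by linarith)]
    gcongr
    exact mul_le_of_le_one_right (by linarith) hz
  have e2 : 1 - r ≤ ‖1 - r * z‖ := by
    have h3 := norm_sub_norm_le (1 : ℂ) (r * z)
    rw [norm_one, norm_mul, Complex.norm_real, Real.norm_of_nonneg h0] at h3
    nlinarith
  linarith

/-- Abel continuity at the boundary for integrals of `log ‖1 - σ e^{iθ}‖`. -/
lemma tendsto_integral_log_norm_one_sub {σ : ℂ} (hσ : ‖σ‖ ≤ 1) {g : ℝ → ℝ} (hg : Continuous g)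
    (hg1 : ∀ θ, |g θ| ≤ 1) :
    Filter.Tendsto (fun r : ℝ => ∫ θ in (0 : ℝ)..(2 * Real.pi),
      Real.log ‖1 - r * (σ * Complex.exp (θ * Complex.I))‖ * g θ) (nhdsWithin 1 (Set.Iio 1))
      (nhds (∫ θ in (0 : ℝ)..(2 * Real.pi),
        Real.log ‖1 - σ * Complex.exp (θ * Complex.I)‖ * g θ)) := by
  have hz : ∀ θ : ℝ, ‖σ * Complex.exp (θ * Complex.I)‖ ≤ 1 := by
    intro θ
    rwa [norm_mul, Complex.norm_exp_ofReal_mul_I, mul_one]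
  have hr : ∀ᶠ r : ℝ in nhdsWithin 1 (Set.Iio 1), 0 < r ∧ r < 1 := by
    filter_upwards [self_mem_nhdsWithin,
      nhdsWithin_le_nhds (lt_mem_nhds (show (0 : ℝ) < 1 by norm_num))] with r h1 h2
    exact ⟨h2, h1⟩
  refine intervalIntegral.tendsto_integral_filter_of_dominated_convergence
    (fun θ => 2 * Real.log 2 + |Real.log ‖1 - σ * Complex.exp (θ * Complex.I)‖|) ?_ ?_ ?_ ?_
  · refine Filter.Eventually.of_forall fun r => Measurable.aestronglyMeasurable ?_
    have := hg.measurable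
    fun_prop
  · filter_upwards [hr] with r hr
    filter_upwards [ae_one_sub_mul_exp_ne_zero σ volume] with θ hθ _
    set z := σ * Complex.exp (θ * Complex.I) with hzdef
    have h1 := norm_one_sub_le_two_mul (hz θ) hr.1.le hr.2.le
    have hp : 0 < ‖1 - z‖ := norm_pos_iff.2 hθ
    have hp2 : 0 < ‖1 - r * z‖ := by linarith
    have h2 : ‖1 - r * z‖ ≤ 2 := by
      refine (norm_sub_le _ _).trans ?_
      rw [norm_one, norm_mul, Complex.norm_real, Real.norm_of_nonneg hr.1.le]
      nlinarith [hz θ, norm_nonneg z, hr.1, hr.2]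
    have h3 := Real.log_le_log hp h1
    rw [Real.log_mul two_ne_zero hp2.ne'] at h3
    have h4 := Real.log_le_log hp2 h2
    have h5 := Real.log_nonneg one_le_two
    have h6 := neg_abs_le (Real.log ‖1 - z‖)
    have h7 := abs_nonneg (Real.log ‖1 - z‖)
    rw [norm_mul]
    refine (mul_le_of_le_one_right (norm_nonneg _) (hg1 θ)).trans ?_
    rw [Real.norm_eq_abs, abs_le]
    constructor <;> linarith
  · exact intervalIntegrable_const.add (intervalIntegrable_log_norm_one_sub σ).abs
  · filter_upwards [ae_one_sub_mul_exp_ne_zero σ volume] with θ hθ _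
    refine Filter.Tendsto.mul_const _ ?_
    refine Filter.Tendsto.log ?_ (norm_ne_zero_iff.2 hθ)
    have hc : Continuous fun r : ℝ => ‖1 - r * (σ * Complex.exp (θ * Complex.I))‖ := by fun_prop
    have h1 := hc.tendsto 1
    simp only [Complex.ofReal_one, one_mul] at h1
    exact h1.mono_left nhdsWithin_le_nhds

/-- The boundary `‖σ‖ = 1` is the case of interest for `x ∈ [0, 1]`, where `σ = w⁻¹` is unimodular;
it follows by letting `r ↑ 1` in the formula for `rσ`. -/
theorem integral_log_norm_one_sub_mul_cos {σ : ℂ} (hσ : ‖σ‖ ≤ 1) {k : ℕ} (hk : k ≠ 0) :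
    ∫ θ in (0 : ℝ)..(2 * Real.pi),
      Real.log ‖1 - σ * Complex.exp (θ * Complex.I)‖ * Real.cos (k * θ) =
      -Real.pi * (σ ^ k).re / k := by
  have h1 := tendsto_integral_log_norm_one_sub hσ (g := fun θ => Real.cos (k * θ)) (by fun_prop)
    (fun θ => Real.abs_cos_le_one _)
  have hc : Continuous fun r : ℝ => -Real.pi * ((r * σ) ^ k).re / k := by
    have := Complex.continuous_re
    fun_prop
  have h2 := (hc.tendsto 1).mono_left (nhdsWithin_le_nhds (s := Set.Iio 1))
  simp only [Complex.ofReal_one, one_mul] at h2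
  refine tendsto_nhds_unique (h1.congr' ?_) h2
  filter_upwards [self_mem_nhdsWithin,
      nhdsWithin_le_nhds (lt_mem_nhds (show (0 : ℝ) < 1 by norm_num))] with r h1 h2
  have h3 : ‖(r : ℂ) * σ‖ < 1 := by
    rw [norm_mul, Complex.norm_real, Real.norm_of_nonneg h2.le]
    have : r < 1 := h1
    nlinarith [norm_nonneg σ]
  rw [← integral_log_norm_one_sub_of_lt h3 hk]
  simp_rw [mul_assoc]

theorem integral_log_norm_one_sub {σ : ℂ} (hσ : ‖σ‖ ≤ 1) :
    ∫ θ in (0 : ℝ)..(2 * Real.pi), Real.log ‖1 - σ * Complex.exp (θ * Complex.I)‖ = 0 := by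
  have h1 := tendsto_integral_log_norm_one_sub hσ (g := fun _ => 1) (by fun_prop) (by simp)
  simp only [mul_one] at h1
  refine tendsto_nhds_unique (h1.congr' ?_) tendsto_const_nhds
  filter_upwards [self_mem_nhdsWithin,
      nhdsWithin_le_nhds (lt_mem_nhds (show (0 : ℝ) < 1 by norm_num))] with r h1 h2
  have h3 : ‖(r : ℂ) * σ‖ < 1 := by
    rw [norm_mul, Complex.norm_real, Real.norm_of_nonneg h2.le]
    have : r < 1 := h1
    nlinarith [norm_nonneg σ]
  have h4 := integral_log_norm_one_sub_zero_of_lt h3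
  simpa only [mul_assoc] using h4

/-! ### Joukowski coordinate and the potentials of cosines -/

/-- The parametrization `θ ↦ (1 + cos θ) / 2` of `[0, 1]` by `[0, π]`. -/
noncomputable def arcPoint (θ : ℝ) : ℝ := (1 + Real.cos θ) / 2

lemma continuous_arcPoint : Continuous arcPoint := by
  unfold arcPoint
  fun_prop

lemma arcPoint_mem_Icc (θ : ℝ) : arcPoint θ ∈ Set.Icc (0 : ℝ) 1 := by
  have h1 := Real.cos_le_one θ
  have h2 := Real.neg_one_le_cos θ
  constructor <;> unfold arcPoint <;> linarith

/-- The Joukowski relation factors `x - arcPoint θ` as `(w / 4)(1 - w⁻¹ e^{iθ})(1 - w⁻¹ e^{-iθ})`.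
The nonvanishing hypotheses are needed to split the logarithm and hold for almost every `θ`. -/
lemma log_abs_sub_arcPoint {w : ℂ} (hw : w ≠ 0) {x : ℝ} (hx : (x : ℂ) = (2 + w + w⁻¹) / 4) {θ : ℝ}
    (h1 : 1 - w⁻¹ * Complex.exp (θ * Complex.I) ≠ 0)
    (h2 : 1 - w⁻¹ * Complex.exp ((-θ : ℝ) * Complex.I) ≠ 0) :
    Real.log |x - arcPoint θ| = (Real.log ‖w‖ - Real.log 4) +
      (Real.log ‖1 - w⁻¹ * Complex.exp (θ * Complex.I)‖ +
        Real.log ‖1 - w⁻¹ * Complex.exp ((-θ : ℝ) * Complex.I)‖) := by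
  have e : ((x - arcPoint θ : ℝ) : ℂ) = w / 4 * ((1 - w⁻¹ * Complex.exp (θ * Complex.I)) *
      (1 - w⁻¹ * Complex.exp ((-θ : ℝ) * Complex.I))) := by
    have h3 : Complex.exp (θ * Complex.I) * Complex.exp ((-θ : ℝ) * Complex.I) = 1 := by
      rw [← Complex.exp_add]
      simp
    have h4 := Complex.two_cos (θ : ℂ)
    have h5 : Complex.exp ((-θ : ℝ) * Complex.I) = Complex.exp (-(θ : ℂ) * Complex.I) := by
      push_cast; rfl
    rw [← h5] at h4
    unfold arcPoint
    generalize Complex.exp (θ * Complex.I) = u at *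
    generalize Complex.exp ((-θ : ℝ) * Complex.I) = v at *
    have h6 : w * (1 - w⁻¹ * u) * (1 - w⁻¹ * v) = w - u - v + w⁻¹ * (u * v) := by
      field_simp
      ring
    push_cast
    rw [hx]
    rw [h3] at h6
    linear_combination (-1 / 4) * h6 - (1 / 4) * h4
  rw [← Real.norm_eq_abs, ← Complex.norm_real, e, norm_mul, norm_mul, norm_div,
    Real.log_mul, Real.log_mul, Real.log_div]
  · simp
  · exact norm_ne_zero_iff.2 hw
  · simp
  · exact norm_ne_zero_iff.2 h1
  · exact norm_ne_zero_iff.2 h2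
  · simpa using hw
  · exact mul_ne_zero (norm_ne_zero_iff.2 h1) (norm_ne_zero_iff.2 h2)

lemma ae_log_abs_sub_arcPoint {w : ℂ} (hw : w ≠ 0) {x : ℝ} (hx : (x : ℂ) = (2 + w + w⁻¹) / 4) :
    ∀ᵐ θ : ℝ, Real.log |x - arcPoint θ| = (Real.log ‖w‖ - Real.log 4) +
      (Real.log ‖1 - w⁻¹ * Complex.exp (θ * Complex.I)‖ +
        Real.log ‖1 - w⁻¹ * Complex.exp ((-θ : ℝ) * Complex.I)‖) := by
  have h1 := ae_one_sub_mul_exp_ne_zero w⁻¹ volume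
  have h2 := (Measure.measurePreserving_neg (volume : Measure ℝ)).quasiMeasurePreserving.ae h1
  filter_upwards [h1, h2] with θ h1 h2
  exact log_abs_sub_arcPoint hw hx h1 h2

lemma exp_two_pi_sub (θ : ℝ) : Complex.exp ((2 * Real.pi - θ : ℝ) * Complex.I) =
    Complex.exp ((-θ : ℝ) * Complex.I) := by
  have : ((2 * Real.pi - θ : ℝ) : ℂ) * Complex.I = 2 * Real.pi * Complex.I +
      (-θ : ℝ) * Complex.I := by
    push_cast; ring
  rw [this, Complex.exp_add, Complex.exp_two_pi_mul_I, one_mul]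

lemma intervalIntegrable_log_norm_half (σ : ℂ) :
    IntervalIntegrable (fun θ : ℝ => Real.log ‖1 - σ * Complex.exp (θ * Complex.I)‖) volume 0
      Real.pi ∧
    IntervalIntegrable (fun θ : ℝ => Real.log ‖1 - σ * Complex.exp ((-θ : ℝ) * Complex.I)‖) volume
      0 Real.pi := by
  have h := intervalIntegrable_log_norm_one_sub σ
  have hp := Real.pi_pos
  constructor
  · refine h.mono_set ?_
    rw [Set.uIcc_of_le hp.le, Set.uIcc_of_le (by positivity)]
    exact Set.Icc_subset_Icc le_rfl (by linarith)
  · have h1 : IntervalIntegrable (fun θ : ℝ =>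
        Real.log ‖1 - σ * Complex.exp (θ * Complex.I)‖) volume (2 * Real.pi) Real.pi := by
      refine h.mono_set ?_
      rw [Set.uIcc_of_ge (by linarith), Set.uIcc_of_le (by positivity)]
      exact Set.Icc_subset_Icc hp.le le_rfl
    have h2 := h1.comp_sub_left (2 * Real.pi)
    simp only [exp_two_pi_sub, sub_self] at h2
    convert h2 using 1
    ring

/-- The reflection `θ ↦ 2π - θ` carries the `e^{-iθ}` term on `[0, π]` to the `e^{iθ}` term on `[π,
2π]` and fixes `cos kθ`. -/
lemma integral_log_norm_fold (σ : ℂ) (k : ℕ) :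
    ∫ θ in (0 : ℝ)..Real.pi, (Real.log ‖1 - σ * Complex.exp (θ * Complex.I)‖ +
        Real.log ‖1 - σ * Complex.exp ((-θ : ℝ) * Complex.I)‖) * Real.cos (k * θ) =
      ∫ θ in (0 : ℝ)..(2 * Real.pi),
        Real.log ‖1 - σ * Complex.exp (θ * Complex.I)‖ * Real.cos (k * θ) := by
  have hp := Real.pi_pos
  have hc : Continuous fun θ : ℝ => Real.cos (k * θ) := by fun_prop
  have i1 := (intervalIntegrable_log_norm_half σ).1.mul_continuousOn hc.continuousOn
  have i2 := (intervalIntegrable_log_norm_half σ).2.mul_continuousOn hc.continuousOn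
  have i3 := (intervalIntegrable_log_norm_one_sub σ).mul_continuousOn hc.continuousOn
  have hsub := intervalIntegral.integral_comp_sub_left (a := 0) (b := Real.pi)
    (fun θ => Real.log ‖1 - σ * Complex.exp (θ * Complex.I)‖ * Real.cos (k * θ)) (2 * Real.pi)
  have hcos : ∀ θ : ℝ, Real.cos (k * (2 * Real.pi - θ)) = Real.cos (k * θ) := by
    intro θ
    rw [mul_sub, Real.cos_nat_mul_two_pi_sub]
  simp only [exp_two_pi_sub, hcos, sub_zero] at hsub
  have e : 2 * Real.pi - Real.pi = Real.pi := by ring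
  rw [e] at hsub
  have i4 : IntervalIntegrable (fun θ : ℝ =>
      Real.log ‖1 - σ * Complex.exp (θ * Complex.I)‖ * Real.cos (k * θ)) volume Real.pi
      (2 * Real.pi) := by
    refine i3.mono_set ?_
    rw [Set.uIcc_of_le (by linarith), Set.uIcc_of_le (by positivity)]
    exact Set.Icc_subset_Icc hp.le le_rfl
  rw [← intervalIntegral.integral_add_adjacent_intervals i1 i4, ← hsub,
    ← intervalIntegral.integral_add i1 i2]
  simp_rw [add_mul]

lemma intervalIntegrable_log_abs_sub_arcPoint {w : ℂ} (hw : w ≠ 0) {x : ℝ}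
    (hx : (x : ℂ) = (2 + w + w⁻¹) / 4) :
    IntervalIntegrable (fun θ => Real.log |x - arcPoint θ|) volume 0 Real.pi := by
  have h := (intervalIntegrable_const (c := Real.log ‖w‖ - Real.log 4)).add
    ((intervalIntegrable_log_norm_half w⁻¹).1.add (intervalIntegrable_log_norm_half w⁻¹).2)
  refine h.congr_ae (ae_restrict_of_ae ?_)
  filter_upwards [ae_log_abs_sub_arcPoint hw hx] with θ hθ
  exact hθ.symm

lemma integral_cos_nat_mul {k : ℕ} (hk : k ≠ 0) :
    ∫ θ in (0 : ℝ)..Real.pi, Real.cos (k * θ) = 0 := by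
  have hk' : (k : ℝ) ≠ 0 := by exact_mod_cast hk
  rw [intervalIntegral.integral_comp_mul_left (fun x => Real.cos x) hk', integral_cos]
  simp [Real.sin_nat_mul_pi]

theorem integral_log_abs_sub_arcPoint_mul_cos {w : ℂ} (hw : 1 ≤ ‖w‖) {x : ℝ}
    (hx : (x : ℂ) = (2 + w + w⁻¹) / 4) {k : ℕ} (hk : k ≠ 0) :
    ∫ θ in (0 : ℝ)..Real.pi, Real.log |x - arcPoint θ| * Real.cos (k * θ) =
      -Real.pi * ((w⁻¹) ^ k).re / k := by
  have hw0 : w ≠ 0 := by rintro rfl; norm_num at hw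
  have hσ : ‖w⁻¹‖ ≤ 1 := by rw [norm_inv]; exact inv_le_one_of_one_le₀ hw
  have hc : Continuous fun θ : ℝ => Real.cos (k * θ) := by fun_prop
  rw [← integral_log_norm_one_sub_mul_cos hσ hk, ← integral_log_norm_fold]
  have h1 : ∫ θ in (0 : ℝ)..Real.pi, Real.log |x - arcPoint θ| * Real.cos (k * θ) =
      ∫ θ in (0 : ℝ)..Real.pi, ((Real.log ‖w‖ - Real.log 4) * Real.cos (k * θ) +
      (Real.log ‖1 - w⁻¹ * Complex.exp (θ * Complex.I)‖ +
        Real.log ‖1 - w⁻¹ * Complex.exp ((-θ : ℝ) * Complex.I)‖) * Real.cos (k * θ)) := by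
    refine intervalIntegral.integral_congr_ae ?_
    filter_upwards [ae_log_abs_sub_arcPoint hw0 hx] with θ hθ _
    rw [hθ, add_mul]
  rw [h1, intervalIntegral.integral_add
    ((hc.intervalIntegrable _ _).const_mul _)
    (((intervalIntegrable_log_norm_half w⁻¹).1.add
      (intervalIntegrable_log_norm_half w⁻¹).2).mul_continuousOn hc.continuousOn),
    intervalIntegral.integral_const_mul, integral_cos_nat_mul hk, mul_zero, zero_add]

theorem integral_log_abs_sub_arcPoint {w : ℂ} (hw : 1 ≤ ‖w‖) {x : ℝ}
    (hx : (x : ℂ) = (2 + w + w⁻¹) / 4) :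
    ∫ θ in (0 : ℝ)..Real.pi, Real.log |x - arcPoint θ| =
      Real.pi * (Real.log ‖w‖ - Real.log 4) := by
  have hw0 : w ≠ 0 := by rintro rfl; norm_num at hw
  have hσ : ‖w⁻¹‖ ≤ 1 := by rw [norm_inv]; exact inv_le_one_of_one_le₀ hw
  have h0 := integral_log_norm_fold w⁻¹ 0
  simp only [Nat.cast_zero, zero_mul, Real.cos_zero, mul_one, integral_log_norm_one_sub hσ] at h0
  rw [intervalIntegral.integral_congr_ae ((ae_log_abs_sub_arcPoint hw0 hx).mono fun θ h _ => h),
    intervalIntegral.integral_add intervalIntegrable_const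
    ((intervalIntegrable_log_norm_half w⁻¹).1.add (intervalIntegrable_log_norm_half w⁻¹).2), h0]
  simp [mul_sub]

/-- The Joukowski coordinate of a point of `[0, 1]`. -/
lemma joukowski_of_mem_Icc (φ : ℝ) :
    ((arcPoint φ : ℝ) : ℂ) = (2 + Complex.exp (φ * Complex.I) + (Complex.exp (φ * Complex.I))⁻¹) / 4
    := by
  have h4 := Complex.two_cos (φ : ℂ)
  rw [← Complex.exp_neg, ← neg_mul, add_assoc, ← h4]
  unfold arcPoint
  push_cast
  ring

lemma exists_arcPoint_eq {x : ℝ} (hx : x ∈ Set.Icc (0 : ℝ) 1) : ∃ φ, arcPoint φ = x := by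
  refine ⟨Real.arccos (2 * x - 1), ?_⟩
  rw [arcPoint, Real.cos_arccos (by linarith [hx.1]) (by linarith [hx.2])]
  ring

/-- The parametrization `t ↦ (1 + cosh t) / 2` of `[1, ∞)`. -/
noncomputable def hypPoint (t : ℝ) : ℝ := (1 + Real.cosh t) / 2

lemma joukowski_of_one_le (t : ℝ) :
    ((hypPoint t : ℝ) : ℂ) = (2 + (Real.exp t : ℂ) + (Real.exp t : ℂ)⁻¹) / 4 := by
  rw [← Complex.ofReal_inv, ← Real.exp_neg, hypPoint, Real.cosh_eq]
  push_cast
  ring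

lemma exists_hypPoint_eq {x : ℝ} (hx : 1 < x) : ∃ t, 0 < t ∧ hypPoint t = x := by
  refine ⟨Real.arcosh (2 * x - 1), Real.arcosh_pos (by linarith), ?_⟩
  rw [hypPoint, Real.cosh_arcosh (by linarith)]
  ring

/-! ### Change of variables to the angle -/

lemma hasDerivAt_arcPoint (θ : ℝ) : HasDerivAt arcPoint (-Real.sin θ / 2) θ := by
  unfold arcPoint
  simpa using ((Real.hasDerivAt_cos θ).const_add 1).div_const 2

lemma injOn_arcPoint : Set.InjOn arcPoint (Set.Ioo 0 Real.pi) := by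
  intro a ha b hb hab
  refine Real.injOn_cos (Set.Ioo_subset_Icc_self ha) (Set.Ioo_subset_Icc_self hb) ?_
  unfold arcPoint at hab
  linarith

lemma arcPoint_mem_Ioo {θ : ℝ} (hθ : θ ∈ Set.Ioo 0 Real.pi) : arcPoint θ ∈ Set.Ioo (0 : ℝ) 1 := by
  have h1 : Real.cos θ < Real.cos 0 :=
    Real.strictAntiOn_cos ⟨le_rfl, Real.pi_pos.le⟩ (Set.Ioo_subset_Icc_self hθ) hθ.1
  have h2 : Real.cos Real.pi < Real.cos θ :=
    Real.strictAntiOn_cos (Set.Ioo_subset_Icc_self hθ) ⟨Real.pi_pos.le, le_rfl⟩ hθ.2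
  rw [Real.cos_zero] at h1
  rw [Real.cos_pi] at h2
  constructor <;> unfold arcPoint <;> linarith

lemma image_arcPoint : arcPoint '' Set.Ioo 0 Real.pi = Set.Ioo 0 1 := by
  ext x
  constructor
  · rintro ⟨θ, hθ, rfl⟩
    exact arcPoint_mem_Ioo hθ
  · intro hx
    refine ⟨Real.arccos (2 * x - 1), ⟨Real.arccos_pos.2 (by linarith [hx.2]),
      Real.arccos_lt_pi.2 (by linarith [hx.1])⟩, ?_⟩
    rw [arcPoint, Real.cos_arccos (by linarith [hx.1]) (by linarith [hx.2])]
    ring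

lemma abs_deriv_arcPoint (θ : ℝ) :
    |-Real.sin θ / 2| = Real.sqrt (arcPoint θ * (1 - arcPoint θ)) := by
  have h1 := Real.sin_sq_add_cos_sq θ
  have h2 : arcPoint θ * (1 - arcPoint θ) = (-Real.sin θ / 2) ^ 2 := by
    unfold arcPoint
    linear_combination (1 / 4) * (-h1)
  rw [h2, Real.sqrt_sq_eq_abs]

/-- The Jacobian of `arcPoint` is `√(s(1 - s))`, so the endpoint singularity of the density
disappears and a polynomial weight remains. -/
lemma sqrt_mul_density {s : ℝ} (hs : s ∈ Set.Ioo (0 : ℝ) 1) :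
    Real.sqrt (s * (1 - s)) * Real.sqrt ((1 - s) / s) = 1 - s := by
  have h1 : 0 < s := hs.1
  have h2 : 0 < 1 - s := by linarith [hs.2]
  rw [← Real.sqrt_mul (by positivity)]
  have : s * (1 - s) * ((1 - s) / s) = (1 - s) ^ 2 := by field_simp
  rw [this, Real.sqrt_sq h2.le]

lemma sqrt_mul_weight {s : ℝ} (hs : s ∈ Set.Ioo (0 : ℝ) 1) :
    Real.sqrt (s * (1 - s)) * Real.sqrt (s / (1 - s)) = s := by
  have h1 : 0 < s := hs.1
  have h2 : 0 < 1 - s := by linarith [hs.2]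
  rw [← Real.sqrt_mul (by positivity)]
  have : s * (1 - s) * (s / (1 - s)) = s ^ 2 := by field_simp
  rw [this, Real.sqrt_sq h1.le]

lemma mul_equilibriumDensity_eq (f : ℝ → ℝ) (h : ℝ[X]) :
    (fun y => f y * equilibriumDensity h y) = (Set.Ioc (0 : ℝ) 1).indicator fun y =>
      f y * ((1 / (2 * Real.pi)) * Real.sqrt ((1 - y) / y) * h.eval y) := by
  ext y
  unfold equilibriumDensity
  by_cases hy : y ∈ Set.Ioc (0 : ℝ) 1 <;> simp [hy]

/-- The density of the equilibrium measure in the angular coordinate. -/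
noncomputable def angularDensity (h : ℝ[X]) (θ : ℝ) : ℝ :=
  (1 / (2 * Real.pi)) * ((1 - arcPoint θ) * h.eval (arcPoint θ))

lemma continuous_angularDensity (h : ℝ[X]) : Continuous (angularDensity h) := by
  have := continuous_arcPoint
  have h2 : Continuous fun θ => h.eval (arcPoint θ) := h.continuous.comp this
  unfold angularDensity
  fun_prop

lemma abs_deriv_smul_density (f : ℝ → ℝ) (h : ℝ[X]) {θ : ℝ} (hθ : θ ∈ Set.Ioo 0 Real.pi) :
    |-Real.sin θ / 2| • (f (arcPoint θ) * ((1 / (2 * Real.pi)) *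
      Real.sqrt ((1 - arcPoint θ) / arcPoint θ) * h.eval (arcPoint θ))) =
      f (arcPoint θ) * angularDensity h θ := by
  rw [abs_deriv_arcPoint θ, smul_eq_mul, angularDensity]
  linear_combination (f (arcPoint θ) * (1 / (2 * Real.pi)) * h.eval (arcPoint θ)) *
    sqrt_mul_density (arcPoint_mem_Ioo hθ)

theorem integral_mul_equilibriumDensity (f : ℝ → ℝ) (h : ℝ[X]) :
    ∫ y, f y * equilibriumDensity h y =
      ∫ θ in (0 : ℝ)..Real.pi, f (arcPoint θ) * angularDensity h θ := by
  rw [mul_equilibriumDensity_eq, integral_indicator measurableSet_Ioc,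
    integral_Ioc_eq_integral_Ioo, ← image_arcPoint,
    integral_image_eq_integral_abs_deriv_smul measurableSet_Ioo
      (fun θ _ => (hasDerivAt_arcPoint θ).hasDerivWithinAt) injOn_arcPoint,
    intervalIntegral.integral_of_le Real.pi_pos.le, integral_Ioc_eq_integral_Ioo]
  exact setIntegral_congr_fun measurableSet_Ioo fun θ hθ => abs_deriv_smul_density f h hθ

theorem integrable_mul_equilibriumDensity_iff (f : ℝ → ℝ) (h : ℝ[X]) :
    Integrable (fun y => f y * equilibriumDensity h y) ↔
      IntervalIntegrable (fun θ => f (arcPoint θ) * angularDensity h θ) volume 0 Real.pi := by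
  rw [mul_equilibriumDensity_eq, integrable_indicator_iff measurableSet_Ioc,
    integrableOn_Ioc_iff_integrableOn_Ioo, ← image_arcPoint,
    integrableOn_image_iff_integrableOn_abs_deriv_smul measurableSet_Ioo
      (fun θ _ => (hasDerivAt_arcPoint θ).hasDerivWithinAt) injOn_arcPoint,
    intervalIntegrable_iff_integrableOn_Ioo_of_le Real.pi_pos.le]
  exact integrableOn_congr_fun (fun θ hθ => abs_deriv_smul_density f h hθ) measurableSet_Ioo

/-- The same cancellation for the weight of the MRS condition, which thereby becomes an arcsine
average of `x Q'(x)` on `[0, β]`. -/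
theorem integral_mul_sqrt_eq (f : ℝ → ℝ) {β : ℝ} (hβ : 0 < β) :
    ∫ x in (0 : ℝ)..β, f x * Real.sqrt (x / (β - x)) =
      ∫ θ in (0 : ℝ)..Real.pi, β * arcPoint θ * f (β * arcPoint θ) := by
  have himg : (fun θ => β * arcPoint θ) '' Set.Ioo 0 Real.pi = Set.Ioo 0 β := by
    rw [← Set.image_image (fun x => β * x), image_arcPoint, Set.image_mul_left_Ioo hβ]
    simp
  have hinj : Set.InjOn (fun θ => β * arcPoint θ) (Set.Ioo 0 Real.pi) := fun a ha b hb hab =>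
    injOn_arcPoint ha hb (mul_left_cancel₀ hβ.ne' hab)
  rw [intervalIntegral.integral_of_le hβ.le, integral_Ioc_eq_integral_Ioo, ← himg,
    integral_image_eq_integral_abs_deriv_smul measurableSet_Ioo
      (fun θ _ => ((hasDerivAt_arcPoint θ).const_mul β).hasDerivWithinAt) hinj,
    intervalIntegral.integral_of_le Real.pi_pos.le, integral_Ioc_eq_integral_Ioo]
  refine setIntegral_congr_fun measurableSet_Ioo fun θ hθ => ?_
  have e : β * arcPoint θ / (β - β * arcPoint θ) = arcPoint θ / (1 - arcPoint θ) := by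
    rw [← mul_one_sub, mul_div_mul_left _ _ hβ.ne']
  simp only [smul_eq_mul]
  rw [abs_mul, abs_of_pos hβ, abs_deriv_arcPoint θ, e]
  linear_combination β * f (β * arcPoint θ) * sqrt_mul_weight (arcPoint_mem_Ioo hθ)

/-! ### Arcsine moments and the square-root quotient -/

/-- The moments of the arcsine distribution on `[0, 1]`. -/
noncomputable def arcMoment (j : ℕ) : ℝ := (1 / Real.pi) * ∫ θ in (0 : ℝ)..Real.pi, arcPoint θ ^ j

lemma integral_arcPoint_pow (j : ℕ) :
    ∫ θ in (0 : ℝ)..Real.pi, arcPoint θ ^ j = Real.pi * arcMoment j := by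
  unfold arcMoment
  field_simp [Real.pi_pos.ne']

/-- Since `arcPoint θ = cos² (θ / 2)`, this is Wallis's integral. -/
lemma arcMoment_eq_prod (j : ℕ) :
    arcMoment j = ∏ i ∈ Finset.range j, (2 * (i : ℝ) + 1) / (2 * i + 2) := by
  have h : ∀ θ : ℝ, arcPoint θ ^ j = Real.cos (θ / 2) ^ (2 * j) := by
    intro θ
    rw [pow_mul, Real.cos_sq, arcPoint]
    congr 1
    ring_nf
  have h2 := EulerSine.integral_cos_pow_eq (2 * j)
  rw [integral_sin_pow_even] at h2
  unfold arcMoment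
  simp_rw [h]
  rw [intervalIntegral.integral_comp_div (fun x => Real.cos x ^ (2 * j)) two_ne_zero, zero_div, h2]
  simp only [smul_eq_mul]
  field_simp [Real.pi_pos.ne']

lemma arcMoment_zero : arcMoment 0 = 1 := by simp [arcMoment_eq_prod]

lemma arcMoment_succ (j : ℕ) :
    arcMoment (j + 1) = arcMoment j * ((2 * (j : ℝ) + 1) / (2 * j + 2)) := by
  rw [arcMoment_eq_prod, arcMoment_eq_prod, Finset.prod_range_succ]

lemma arcMoment_pos (j : ℕ) : 0 < arcMoment j := by
  rw [arcMoment_eq_prod]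
  exact Finset.prod_pos fun i _ => by positivity

lemma arcMoment_antitone : Antitone arcMoment := by
  refine antitone_nat_of_succ_le fun j => ?_
  rw [arcMoment_succ]
  refine mul_le_of_le_one_right (arcMoment_pos j).le ?_
  rw [div_le_one (by positivity)]
  linarith

lemma arcMoment_le_one (j : ℕ) : arcMoment j ≤ 1 :=
  (arcMoment_antitone (Nat.zero_le j)).trans_eq arcMoment_zero

/-- Both sequences start at 1 and have successive ratio `(2j + 1) / (2j + 2)`. Hence the binomial
series of `(1 - x)^{-1/2}` is the moment series of the arcsine law. -/
lemma ring_multichoose_half (j : ℕ) : Ring.multichoose (1 / 2 : ℂ) j = arcMoment j := by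
  have hf : ∀ n : ℕ, (n.factorial : ℂ) * Ring.multichoose (1 / 2 : ℂ) n =
      (ascPochhammer ℂ n).eval (1 / 2) := by
    intro n
    rw [← ascPochhammer_smeval_eq_eval, ← Ring.factorial_nsmul_multichoose_eq_ascPochhammer,
      nsmul_eq_mul]
  induction j with
  | zero => simp [arcMoment_zero]
  | succ j ih =>
    have h1 := hf (j + 1)
    rw [ascPochhammer_succ_eval, ← hf j, ih, Nat.factorial_succ] at h1
    have h2 : (j.factorial : ℂ) ≠ 0 := by exact_mod_cast Nat.factorial_ne_zero j
    have h3 : (j + 1 : ℂ) ≠ 0 := by exact_mod_cast Nat.succ_ne_zero j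
    have h4 : (2 * j + 2 : ℂ) ≠ 0 := by
      have : (2 * j + 2 : ℂ) = 2 * (j + 1) := by ring
      rw [this]; exact mul_ne_zero two_ne_zero h3
    rw [arcMoment_succ]
    push_cast at h1 ⊢
    have h5 : (j + 1 : ℂ) * Ring.multichoose (1 / 2 : ℂ) (j + 1) = arcMoment j * (1 / 2 + j) := by
      apply mul_left_cancel₀ h2
      linear_combination h1
    field_simp
    linear_combination 2 * h5

theorem hasSum_arcMoment_cpow {x : ℂ} (hx : ‖x‖ < 1) :
    HasSum (fun j => (arcMoment j : ℂ) * x ^ j) (1 / (1 - x) ^ (1 / 2 : ℂ)) := by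
  have h := (Complex.one_div_one_sub_cpow_hasFPowerSeriesOnBall_zero (1 / 2)).hasSum
    (y := x) (by simpa [enorm_eq_nnnorm] using! hx)
  simp only [zero_add, FormalMultilinearSeries.ofScalars_apply_eq, ← Ring.multichoose_eq,
    ring_multichoose_half, smul_eq_mul] at h
  exact h

theorem hasSum_arcMoment_integral {x : ℂ} (hx : ‖x‖ < 1) :
    HasSum (fun j => (arcMoment j : ℂ) * x ^ j)
      ((1 / Real.pi) * ∫ θ in (0 : ℝ)..Real.pi, 1 / (1 - arcPoint θ * x)) := by
  have hb : ∀ θ, ‖(arcPoint θ : ℂ) * x‖ ≤ ‖x‖ := by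
    intro θ
    have := arcPoint_mem_Icc θ
    rw [norm_mul, Complex.norm_real, Real.norm_of_nonneg this.1]
    exact mul_le_of_le_one_left (norm_nonneg _) this.2
  have hcont := continuous_arcPoint
  have hs : HasSum (fun j : ℕ => ∫ θ in (0 : ℝ)..Real.pi, ((arcPoint θ : ℂ) * x) ^ j)
      (∫ θ in (0 : ℝ)..Real.pi, 1 / (1 - arcPoint θ * x)) := by
    refine intervalIntegral.hasSum_integral_of_dominated_convergence
      (fun j _ => ‖x‖ ^ j) (fun j => Continuous.aestronglyMeasurable (by fun_prop)) ?_ ?_ ?_ ?_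
    · refine fun j => Filter.Eventually.of_forall fun θ _ => ?_
      rw [norm_pow]
      exact pow_le_pow_left₀ (norm_nonneg _) (hb θ) j
    · exact Filter.Eventually.of_forall fun θ _ => summable_geometric_of_lt_one (norm_nonneg _) hx
    · exact intervalIntegrable_const
    · refine Filter.Eventually.of_forall fun θ _ => ?_
      rw [one_div]
      exact hasSum_geometric_of_norm_lt_one ((hb θ).trans_lt hx)
  have h2 := hs.mul_left (1 / Real.pi : ℂ)
  suffices e : ∀ j : ℕ, (arcMoment j : ℂ) * x ^ j = (1 / Real.pi : ℂ) *
      ∫ θ in (0 : ℝ)..Real.pi, ((arcPoint θ : ℂ) * x) ^ j by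
    simp_rw [e]
    exact h2
  intro j
  simp_rw [mul_pow]
  rw [intervalIntegral.integral_mul_const]
  have h3 : ∫ θ in (0 : ℝ)..Real.pi, (arcPoint θ : ℂ) ^ j = (Real.pi * arcMoment j : ℝ) := by
    rw [← integral_arcPoint_pow, ← intervalIntegral.integral_ofReal]
    push_cast
    rfl
  rw [h3]
  have : (Real.pi : ℂ) ≠ 0 := by exact_mod_cast Real.pi_pos.ne'
  push_cast
  field_simp

/-- The point is that the principal branches match: `log y - log (y - 1)` has imaginary part in
`(-π, π]`, so it is the principal logarithm of `(1 - y⁻¹)⁻¹` with no `2πi` correction. -/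
lemma cpow_half_div_cpow_half {y : ℂ} (hy : 1 < ‖y‖) :
    y ^ (1 / 2 : ℂ) / (y - 1) ^ (1 / 2 : ℂ) = 1 / (1 - y⁻¹) ^ (1 / 2 : ℂ) := by
  have hy0 : y ≠ 0 := by rintro rfl; norm_num at hy
  have hy1 : y - 1 ≠ 0 := by
    intro h
    rw [sub_eq_zero] at h
    rw [h] at hy
    norm_num at hy
  have hyinv : ‖y⁻¹‖ < 1 := by rw [norm_inv]; exact inv_lt_one_of_one_lt₀ hy
  have hre : 0 < (1 - y⁻¹).re := by
    have := (Complex.abs_re_le_norm y⁻¹).trans_lt hyinv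
    rw [abs_lt] at this
    rw [Complex.sub_re, Complex.one_re]
    linarith [this.2]
  have hne : 1 - y⁻¹ ≠ 0 := by
    intro h
    rw [h] at hre
    simp at hre
  have harg : (1 - y⁻¹).arg ≠ Real.pi := by
    intro h
    rw [Complex.arg_eq_pi_iff] at h
    linarith [h.1]
  have hexp : Complex.exp (Complex.log y - Complex.log (y - 1)) = (1 - y⁻¹)⁻¹ := by
    rw [Complex.exp_sub, Complex.exp_log hy0, Complex.exp_log hy1]
    field_simp
  have him : -Real.pi < (Complex.log y - Complex.log (y - 1)).im ∧
      (Complex.log y - Complex.log (y - 1)).im ≤ Real.pi := by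
    rw [Complex.sub_im, Complex.log_im, Complex.log_im]
    have him1 : (y - 1).im = y.im := by simp
    rcases le_or_gt 0 y.im with h | h
    · have h1 := Complex.arg_nonneg_iff.2 h
      have h2 := Complex.arg_nonneg_iff.2 (him1.symm ▸ h : 0 ≤ (y - 1).im)
      have h3 := Complex.arg_le_pi y
      have h4 := Complex.arg_le_pi (y - 1)
      refine ⟨lt_of_le_of_ne (by linarith) fun h5 => ?_, by linarith⟩
      have h6 : y.arg = 0 := by linarith
      have h7 : (y - 1).arg = Real.pi := by linarith
      rw [Complex.arg_eq_zero_iff] at h6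
      rw [Complex.arg_eq_pi_iff] at h7
      have h8 : ‖y‖ = |y.re| := by
        rw [← Complex.re_add_im y, h6.2]
        simp
      rw [h8, abs_of_nonneg h6.1] at hy
      have := h7.1
      simp at this
      linarith
    · have h1 := Complex.arg_neg_iff.2 h
      have h2 := Complex.arg_neg_iff.2 (him1.symm ▸ h : (y - 1).im < 0)
      have h3 := Complex.neg_pi_lt_arg y
      have h4 := Complex.neg_pi_lt_arg (y - 1)
      constructor <;> linarith
  have hlog := Complex.log_exp him.1 him.2
  rw [hexp, Complex.log_inv _ harg] at hlog
  rw [Complex.cpow_def_of_ne_zero hy0, Complex.cpow_def_of_ne_zero hy1,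
    Complex.cpow_def_of_ne_zero hne, ← Complex.exp_sub, one_div (Complex.exp _),
    ← Complex.exp_neg]
  congr 1
  linear_combination (-1 / 2) * hlog

/-- Both sides are the series `∑ arcMoment j * y⁻¹ ^ j`. -/
theorem cpow_half_div_eq_integral {y : ℂ} (hy : 1 < ‖y‖) :
    y ^ (1 / 2 : ℂ) / (y - 1) ^ (1 / 2 : ℂ) =
      (1 / Real.pi) * ∫ θ in (0 : ℝ)..Real.pi, y / (y - arcPoint θ) := by
  have hyinv : ‖y⁻¹‖ < 1 := by rw [norm_inv]; exact inv_lt_one_of_one_lt₀ hy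
  have hy0 : y ≠ 0 := by rintro rfl; norm_num at hy
  rw [cpow_half_div_cpow_half hy,
    (hasSum_arcMoment_cpow hyinv).unique (hasSum_arcMoment_integral hyinv)]
  congr 1
  refine intervalIntegral.integral_congr fun θ _ => ?_
  have : (1 : ℂ) - arcPoint θ * y⁻¹ = (y - arcPoint θ) / y := by field_simp
  simp only [this, one_div_div]

/-! ### The contour integral as an averaged divided difference -/

lemma intervalIntegral_swap_of_continuous {f : ℝ → ℝ → ℂ} (hf : Continuous (Function.uncurry f))
    {a b c d : ℝ} (hab : a ≤ b) (hcd : c ≤ d) :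
    ∫ x in a..b, ∫ y in c..d, f x y = ∫ y in c..d, ∫ x in a..b, f x y := by
  simp only [intervalIntegral.integral_of_le hab, intervalIntegral.integral_of_le hcd]
  refine integral_integral_swap ?_
  rw [Measure.prod_restrict]
  exact (hf.continuousOn.integrableOn_compact (isCompact_Icc.prod isCompact_Icc)).mono_set
    (Set.prod_mono Set.Ioc_subset_Icc_self Set.Ioc_subset_Icc_self)

lemma circleIntegral_aeval_div (W : ℝ[X]) {R : ℝ} {w : ℂ} (hw : ‖w‖ < R) :
    ∮ y in C((0 : ℂ), R), (y - w)⁻¹ * aeval y W = 2 * Real.pi * Complex.I * aeval w W := by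
  have h := DifferentiableOn.circleIntegral_sub_inv_smul (c := 0) (R := R) (w := w)
    (f := fun y => aeval y W) (Polynomial.differentiable_aeval W).differentiableOn
    (by simpa using hw)
  simpa using h

lemma circleIntegral_aeval_div_div (W : ℝ[X]) {R : ℝ} {s z : ℂ} (hs : ‖s‖ < R) (hz : ‖z‖ < R)
    (hsz : z ≠ s) :
    ∮ y in C((0 : ℂ), R), aeval y W / ((y - s) * (y - z)) =
      2 * Real.pi * Complex.I * ((aeval z W - aeval s W) / (z - s)) := by
  have hR : 0 < R := (norm_nonneg _).trans_lt hs
  have hne : ∀ w : ℂ, ‖w‖ < R → ∀ y ∈ Metric.sphere (0 : ℂ) R, y - w ≠ 0 := by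
    intro w hw y hy h
    rw [sub_eq_zero] at h
    rw [mem_sphere_zero_iff_norm, h] at hy
    exact hw.ne hy
  have hint : ∀ w : ℂ, ‖w‖ < R → CircleIntegrable (fun y => (y - w)⁻¹ * aeval y W) 0 R := by
    intro w hw
    refine ContinuousOn.circleIntegrable hR.le ?_
    refine ContinuousOn.mul (ContinuousOn.inv₀ (by fun_prop) (hne w hw)) ?_
    exact (Polynomial.differentiable_aeval W).continuous.continuousOn
  have h1 : ∮ y in C((0 : ℂ), R), aeval y W / ((y - s) * (y - z)) =
      ∮ y in C((0 : ℂ), R), (z - s)⁻¹ * ((y - z)⁻¹ * aeval y W - (y - s)⁻¹ * aeval y W) := by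
    refine circleIntegral.integral_congr hR.le fun y hy => ?_
    have h2 := hne s hs y hy
    have h3 := hne z hz y hy
    have h4 : z - s ≠ 0 := sub_ne_zero.2 hsz
    field_simp
    ring
  rw [h1, circleIntegral.integral_const_mul, circleIntegral.integral_sub (hint z hz) (hint s hs),
    circleIntegral_aeval_div W hz, circleIntegral_aeval_div W hs]
  ring

/-- Replacing the branch quotient by its arcsine average and exchanging integrals leaves, for each
`θ`, a contour integral with simple poles at `arcPoint θ` and `z`. The numerator `y` of the average
combines with `V'` into `X * derivative V`. -/
theorem contour_eq_divided_difference (V : ℝ[X]) {R : ℝ} (hR : 1 < R) {z : ℂ} (hz : ‖z‖ < R)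
    (hz1 : z ∉ ((fun x : ℝ => (x : ℂ)) '' Set.Icc (0 : ℝ) 1)) :
    (1 / (2 * (Real.pi : ℂ) * Complex.I)) *
        ∮ y in C((0 : ℂ), R),
          y ^ (1 / 2 : ℂ) / (y - 1) ^ (1 / 2 : ℂ) * aeval y V.derivative * (1 / (y - z)) =
      (1 / Real.pi) * ∫ θ in (0 : ℝ)..Real.pi,
        (aeval z (X * derivative V) - aeval (arcPoint θ : ℂ) (X * derivative V)) /
          (z - arcPoint θ) := by
  have hR0 : 0 < R := by linarith
  have hs : ∀ θ, ‖(arcPoint θ : ℂ)‖ < R := by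
    intro θ
    have := arcPoint_mem_Icc θ
    rw [Complex.norm_real, Real.norm_of_nonneg this.1]
    linarith [this.2]
  have hne : ∀ w : ℂ, ‖w‖ < R → ∀ φ, circleMap 0 R φ - w ≠ 0 := by
    intro w hw φ h
    rw [sub_eq_zero] at h
    have h2 : ‖circleMap 0 R φ‖ = R := by simp [abs_of_pos hR0]
    rw [h] at h2
    exact hw.ne h2
  have hzs : ∀ θ, z ≠ arcPoint θ := fun θ h => hz1 ⟨arcPoint θ, arcPoint_mem_Icc θ, h.symm⟩
  let f : ℝ → ℝ → ℂ := fun φ θ => deriv (circleMap 0 R) φ •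
    (aeval (circleMap 0 R φ) (X * derivative V) /
      ((circleMap 0 R φ - arcPoint θ) * (circleMap 0 R φ - z)))
  have hcont : Continuous (Function.uncurry f) := by
    have h1 := continuous_arcPoint
    have h2 : Continuous (fun y : ℂ => aeval y (X * derivative V)) :=
      (Polynomial.differentiable_aeval _).continuous
    have h3 := continuous_circleMap 0 R
    simp only [f, deriv_circleMap]
    change Continuous fun p : ℝ × ℝ => (circleMap 0 R p.1 * Complex.I) *
      (aeval (circleMap 0 R p.1) (X * derivative V) /
        ((circleMap 0 R p.1 - arcPoint p.2) * (circleMap 0 R p.1 - z)))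
    refine Continuous.mul ?_ (Continuous.div ?_ ?_ ?_)
    · fun_prop
    · fun_prop
    · fun_prop
    · exact fun p => mul_ne_zero (hne _ (hs _) _) (hne _ hz _)
  have h1 : ∮ y in C((0 : ℂ), R),
      y ^ (1 / 2 : ℂ) / (y - 1) ^ (1 / 2 : ℂ) * aeval y V.derivative * (1 / (y - z)) =
      (1 / Real.pi) * ∫ φ in (0 : ℝ)..(2 * Real.pi), ∫ θ in (0 : ℝ)..Real.pi, f φ θ := by
    rw [circleIntegral, ← intervalIntegral.integral_const_mul]
    refine intervalIntegral.integral_congr fun φ _ => ?_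
    have hy : 1 < ‖circleMap 0 R φ‖ := by simpa [abs_of_pos hR0] using hR
    simp only [f, smul_eq_mul]
    rw [cpow_half_div_eq_integral hy, intervalIntegral.integral_const_mul]
    have h2 : ∀ θ : ℝ, aeval (circleMap 0 R φ) (X * derivative V) /
      ((circleMap 0 R φ - arcPoint θ) * (circleMap 0 R φ - z)) =
      (aeval (circleMap 0 R φ) (derivative V) / (circleMap 0 R φ - z)) *
        (circleMap 0 R φ / (circleMap 0 R φ - arcPoint θ)) := by
      intro θ
      rw [map_mul, aeval_X]
      have h3 := hne _ (hs θ) φ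
      have h4 := hne _ hz φ
      field_simp
    simp_rw [h2]
    rw [intervalIntegral.integral_const_mul]
    ring
  rw [h1, intervalIntegral_swap_of_continuous hcont (by positivity) Real.pi_pos.le]
  have h5 : ∀ θ : ℝ, ∫ φ in (0 : ℝ)..(2 * Real.pi), f φ θ = 2 * Real.pi * Complex.I *
      ((aeval z (X * derivative V) - aeval (arcPoint θ : ℂ) (X * derivative V)) /
          (z - arcPoint θ)) := by
    intro θ
    rw [← circleIntegral_aeval_div_div (X * derivative V) (hs θ) hz (hzs θ)]
    rfl
  simp_rw [h5]
  rw [intervalIntegral.integral_const_mul]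
  have hpi : (Real.pi : ℂ) ≠ 0 := by exact_mod_cast Real.pi_pos.ne'
  field_simp

/-- The average over the arcsine distribution of the divided differences of `W`. -/
noncomputable def arcDividedDifference (W : ℝ[X]) : ℝ[X] :=
  ∑ k ∈ Finset.range (W.natDegree + 1),
    C (W.coeff k) * ∑ j ∈ Finset.range k, C (arcMoment j) * X ^ (k - 1 - j)

lemma aeval_sub_div_eq (W : ℝ[X]) {z s : ℂ} (h : z ≠ s) :
    (aeval z W - aeval s W) / (z - s) = ∑ k ∈ Finset.range (W.natDegree + 1),
      (W.coeff k : ℂ) * ∑ j ∈ Finset.range k, s ^ j * z ^ (k - 1 - j) := by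
  have h0 : z - s ≠ 0 := sub_ne_zero.2 h
  rw [div_eq_iff h0, aeval_eq_sum_range, aeval_eq_sum_range, ← Finset.sum_sub_distrib,
    Finset.sum_mul]
  refine Finset.sum_congr rfl fun k _ => ?_
  have := geom_sum₂_mul s z k
  simp only [Complex.real_smul]
  linear_combination (W.coeff k : ℂ) * this

theorem aeval_arcDividedDifference (W : ℝ[X]) {z : ℂ} (hz : ∀ θ, z ≠ arcPoint θ) :
    aeval z (arcDividedDifference W) = (1 / Real.pi) * ∫ θ in (0 : ℝ)..Real.pi,
      (aeval z W - aeval (arcPoint θ : ℂ) W) / (z - arcPoint θ) := by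
  have hcont := continuous_arcPoint
  have hint : ∀ k j : ℕ, IntervalIntegrable (fun θ => (arcPoint θ : ℂ) ^ j * z ^ (k - 1 - j))
      volume 0 Real.pi := fun k j => Continuous.intervalIntegrable (by fun_prop) _ _
  have hint2 : ∀ k : ℕ, IntervalIntegrable (fun θ => (W.coeff k : ℂ) *
      ∑ j ∈ Finset.range k, (arcPoint θ : ℂ) ^ j * z ^ (k - 1 - j)) volume 0 Real.pi :=
    fun k => Continuous.intervalIntegrable (by fun_prop) _ _
  simp_rw [fun θ => aeval_sub_div_eq W (hz θ)]
  rw [intervalIntegral.integral_finsetSum fun k _ => hint2 k, arcDividedDifference, map_sum,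
    Finset.mul_sum]
  refine Finset.sum_congr rfl fun k _ => ?_
  rw [intervalIntegral.integral_const_mul, intervalIntegral.integral_finsetSum fun j _ => hint k j,
    map_mul, map_sum, aeval_C, mul_left_comm,
    Finset.mul_sum]
  simp only [Complex.coe_algebraMap]
  rw [Finset.mul_sum, Finset.mul_sum]
  refine Finset.sum_congr rfl fun j _ => ?_
  rw [intervalIntegral.integral_mul_const]
  have h3 : ∫ θ in (0 : ℝ)..Real.pi, (arcPoint θ : ℂ) ^ j = (Real.pi * arcMoment j : ℝ) := by
    rw [← integral_arcPoint_pow, ← intervalIntegral.integral_ofReal]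
    push_cast
    rfl
  have hpi : (Real.pi : ℂ) ≠ 0 := by exact_mod_cast Real.pi_pos.ne'
  rw [h3]
  simp only [map_mul, aeval_C, aeval_X, map_pow, Complex.coe_algebraMap]
  push_cast
  field_simp

theorem isDensityPolynomial_arcDividedDifference (V : ℝ[X]) :
    IsDensityPolynomial V (arcDividedDifference (X * derivative V)) := by
  intro z hz R hR hzR
  rw [contour_eq_divided_difference V hR hzR hz, aeval_arcDividedDifference]
  exact fun θ h => hz ⟨arcPoint θ, arcPoint_mem_Icc θ, h.symm⟩

/-- The real points beyond 1 avoid the cut and are infinitely many, so the contour values there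
determine `h`. -/
theorem IsDensityPolynomial.eq_arcDividedDifference {V h : ℝ[X]} (hh : IsDensityPolynomial V h) :
    h = arcDividedDifference (X * derivative V) := by
  refine Polynomial.eq_of_infinite_eval_eq _ _ ((Set.Ioi_infinite (1 : ℝ)).mono fun x hx => ?_)
  have hx : 1 < x := hx
  have hz : (x : ℂ) ∉ ((fun x : ℝ => (x : ℂ)) '' Set.Icc (0 : ℝ) 1) := by
    rintro ⟨y, hy, hxy⟩
    have : y = x := Complex.ofReal_injective hxy
    linarith [hy.2]
  have hn : ‖(x : ℂ)‖ < x + 1 := by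
    rw [Complex.norm_real, Real.norm_of_nonneg (by linarith)]
    linarith
  have h1 := (hh x hz (x + 1) (by linarith) hn).trans
    (isDensityPolynomial_arcDividedDifference V x hz (x + 1) (by linarith) hn).symm
  have h2 : ∀ p : ℝ[X], aeval (x : ℂ) p = ((p.eval x : ℝ) : ℂ) := by
    intro p
    have := Polynomial.aeval_algebraMap_apply ℂ x p
    simpa using this
  rw [h2, h2] at h1
  exact_mod_cast h1

/-! ### Chebyshev expansion of the field and of `(x - 1) h(x)` -/

/-- The Chebyshev polynomial `T_k` shifted to `[0, 1]`. -/
noncomputable def shiftedT (k : ℕ) : ℝ[X] := (Chebyshev.T ℝ (k : ℤ)).comp (2 * X - 1)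

lemma shiftedT_eval_arcPoint (k : ℕ) (θ : ℝ) :
    (shiftedT k).eval (arcPoint θ) = Real.cos (k * θ) := by
  have h : 2 * arcPoint θ - 1 = Real.cos θ := by unfold arcPoint; ring
  rw [shiftedT, eval_comp]
  simp [h, Chebyshev.T_real_cos]

lemma shiftedT_eval_hypPoint (k : ℕ) (t : ℝ) :
    (shiftedT k).eval (hypPoint t) = Real.cosh (k * t) := by
  have h : 2 * hypPoint t - 1 = Real.cosh t := by unfold hypPoint; ring
  rw [shiftedT, eval_comp]
  simp [h, Chebyshev.T_real_cosh]

lemma X_mul_shiftedT_mem_span (k : ℕ) :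
    X * shiftedT k ∈ Submodule.span ℝ (Set.range shiftedT) := by
  have hmem : ∀ j, shiftedT j ∈ Submodule.span ℝ (Set.range shiftedT) := fun j =>
    Submodule.subset_span ⟨j, rfl⟩
  rcases k with _ | k
  · have : X * shiftedT 0 = (1 / 2 : ℝ) • shiftedT 0 + (1 / 2 : ℝ) • shiftedT 1 := by
      simp only [shiftedT, Nat.cast_zero, Nat.cast_one, Chebyshev.T_zero, Chebyshev.T_one, one_comp,
        X_comp, smul_eq_C_mul]
      have h2 : (2 : ℝ[X]) * C (1 / 2) = 1 := by
        rw [← C_ofNat, ← C_mul]; norm_num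
      linear_combination (-X) * h2
    rw [this]
    exact Submodule.add_mem _ (Submodule.smul_mem _ _ (hmem _)) (Submodule.smul_mem _ _ (hmem _))
  · have : X * shiftedT (k + 1) = (1 / 2 : ℝ) • shiftedT (k + 1) +
        ((1 / 4 : ℝ) • shiftedT (k + 2) + (1 / 4 : ℝ) • shiftedT k) := by
      have h := congrArg (fun p : ℝ[X] => p.comp (2 * X - 1)) (Chebyshev.T_add_two ℝ (k : ℤ))
      simp only [sub_comp, mul_comp, X_comp, ofNat_comp] at h
      simp only [shiftedT, smul_eq_C_mul]
      push_cast
      rw [h]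
      have h2 : (4 : ℝ[X]) * C (1 / 4) = 1 := by
        rw [← C_ofNat, ← C_mul]; norm_num
      have h3 : C (1 / 2 : ℝ) = 2 * C (1 / 4) := by
        rw [← C_ofNat, ← C_mul]; norm_num
      rw [h3]
      linear_combination (-X * (Chebyshev.T ℝ ((k : ℤ) + 1)).comp (2 * X - 1)) * h2
    rw [this]
    exact Submodule.add_mem _ (Submodule.smul_mem _ _ (hmem _))
      (Submodule.add_mem _ (Submodule.smul_mem _ _ (hmem _)) (Submodule.smul_mem _ _ (hmem _)))

/-- The three-term recurrence makes the span stable under multiplication by `X`, and it contains 1.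
-/
lemma span_shiftedT : Submodule.span ℝ (Set.range shiftedT) = ⊤ := by
  have hX : ∀ p ∈ Submodule.span ℝ (Set.range shiftedT),
      X * p ∈ Submodule.span ℝ (Set.range shiftedT) := by
    intro p hp
    induction hp using Submodule.span_induction with
    | mem x hx => obtain ⟨k, rfl⟩ := hx; exact X_mul_shiftedT_mem_span k
    | zero => simp
    | add p q _ _ h1 h2 => rw [mul_add]; exact Submodule.add_mem _ h1 h2
    | smul a p _ h => rw [mul_smul_comm]; exact Submodule.smul_mem _ _ h
  have hpow : ∀ n : ℕ, (X : ℝ[X]) ^ n ∈ Submodule.span ℝ (Set.range shiftedT) := by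
    intro n
    induction n with
    | zero => exact Submodule.subset_span ⟨0, by simp [shiftedT]⟩
    | succ n ih => rw [pow_succ']; exact hX _ ih
  rw [eq_top_iff]
  intro p _
  rw [p.as_sum_range_C_mul_X_pow]
  refine Submodule.sum_mem _ fun i _ => ?_
  rw [← smul_eq_C_mul]
  exact Submodule.smul_mem _ _ (hpow i)

lemma exists_eq_sum_shiftedT (V : ℝ[X]) :
    ∃ (s : Finset ℕ) (b : ℕ → ℝ), V = ∑ k ∈ s, C (b k) * shiftedT k := by
  have h : V ∈ Submodule.span ℝ (Set.range shiftedT) := by rw [span_shiftedT]; trivial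
  obtain ⟨c, hc⟩ := Finsupp.mem_span_range_iff_exists_finsupp.1 h
  refine ⟨c.support, c, ?_⟩
  rw [← hc, Finsupp.sum]
  simp_rw [smul_eq_C_mul]

lemma one_lt_hypPoint {t : ℝ} (ht : 0 < t) : 1 < hypPoint t := by
  have := Real.one_lt_cosh.2 ht.ne'
  unfold hypPoint
  linarith

lemma hypPoint_mul_sub_one (t : ℝ) : hypPoint t * (hypPoint t - 1) = (Real.sinh t / 2) ^ 2 := by
  have := Real.cosh_sq t
  unfold hypPoint
  linear_combination (1 / 4) * this

lemma hasDerivAt_hypPoint (t : ℝ) : HasDerivAt hypPoint (Real.sinh t / 2) t := by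
  unfold hypPoint
  exact ((Real.hasDerivAt_cosh t).const_add 1).div_const 2

lemma tendsto_hypPoint : Filter.Tendsto hypPoint Filter.atTop Filter.atTop := by
  have h : Filter.Tendsto (fun t : ℝ => t / 4) Filter.atTop Filter.atTop :=
    Filter.tendsto_id.atTop_div_const (by norm_num)
  refine Filter.tendsto_atTop_mono (fun t => ?_) h
  have h1 := Real.add_one_le_exp t
  have h2 := Real.exp_pos (-t)
  rw [hypPoint, Real.cosh_eq]
  linarith

lemma ofReal_eval_eq_aeval (p : ℝ[X]) (x : ℝ) : ((p.eval x : ℝ) : ℂ) = aeval (x : ℂ) p := by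
  have := Polynomial.aeval_algebraMap_apply ℂ x p
  simpa using this.symm

lemma eval_arcDividedDifference (W : ℝ[X]) {y : ℝ} (hy : 1 < y) :
    (arcDividedDifference W).eval y = (1 / Real.pi) * ∫ θ in (0 : ℝ)..Real.pi,
      (W.eval y - W.eval (arcPoint θ)) / (y - arcPoint θ) := by
  have hz : ∀ θ, (y : ℂ) ≠ arcPoint θ := by
    intro θ h
    have h1 : y = arcPoint θ := Complex.ofReal_injective h
    linarith [(arcPoint_mem_Icc θ).2]
  apply Complex.ofReal_injective
  rw [ofReal_eval_eq_aeval, aeval_arcDividedDifference W hz]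
  push_cast
  rw [← intervalIntegral.integral_ofReal]
  push_cast
  simp_rw [ofReal_eval_eq_aeval]

lemma integral_inv_sub_arcPoint {y : ℝ} (hy : 1 < y) :
    (1 / Real.pi) * ∫ θ in (0 : ℝ)..Real.pi, (y - arcPoint θ)⁻¹ = (Real.sqrt (y * (y - 1)))⁻¹ := by
  have hn : 1 < ‖(y : ℂ)‖ := by rw [Complex.norm_real, Real.norm_of_nonneg (by linarith)]; exact hy
  have h := cpow_half_div_eq_integral hn
  have h1 : (y : ℂ) ^ (1 / 2 : ℂ) = (Real.sqrt y : ℝ) := by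
    rw [Real.sqrt_eq_rpow, Complex.ofReal_cpow (by linarith)]
    norm_num
  have h2 : ((y : ℂ) - 1) ^ (1 / 2 : ℂ) = (Real.sqrt (y - 1) : ℝ) := by
    rw [Real.sqrt_eq_rpow, Complex.ofReal_cpow (by linarith)]
    norm_num
  have h3 : ∫ θ in (0 : ℝ)..Real.pi, (y : ℂ) / (y - arcPoint θ) =
      ((∫ θ in (0 : ℝ)..Real.pi, y / (y - arcPoint θ) : ℝ) : ℂ) := by
    rw [← intervalIntegral.integral_ofReal]
    push_cast
    rfl
  rw [h1, h2, h3] at h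
  have h4 : Real.sqrt y / Real.sqrt (y - 1) =
      (1 / Real.pi) * ∫ θ in (0 : ℝ)..Real.pi, y / (y - arcPoint θ) := by exact_mod_cast h
  simp_rw [div_eq_mul_inv y] at h4
  rw [intervalIntegral.integral_const_mul] at h4
  have hy0 : 0 < y := by linarith
  have e1 : 0 < Real.sqrt y := Real.sqrt_pos.2 hy0
  have e2 : 0 < Real.sqrt (y - 1) := Real.sqrt_pos.2 (by linarith)
  have e3 := Real.mul_self_sqrt hy0.le
  rw [Real.sqrt_mul hy0.le]
  generalize (∫ θ in (0 : ℝ)..Real.pi, (y - arcPoint θ)⁻¹) = I at *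
  have h5 : (1 / Real.pi) * I = (Real.sqrt y / Real.sqrt (y - 1)) / y := by
    rw [h4]; field_simp
  rw [h5]
  field_simp
  linarith

/-- Obtained by differentiating `V(hypPoint t) = ∑ b_k cosh kt` in `t`. -/
lemma eval_derivative_mul_sinh {V : ℝ[X]} {s : Finset ℕ} {b : ℕ → ℝ}
    (hV : V = ∑ k ∈ s, C (b k) * shiftedT k) (t : ℝ) :
    (derivative V).eval (hypPoint t) * (Real.sinh t / 2) =
      ∑ k ∈ s, k * b k * Real.sinh (k * t) := by
  have h1 : HasDerivAt (fun t => V.eval (hypPoint t))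
      ((derivative V).eval (hypPoint t) * (Real.sinh t / 2)) t :=
    (V.hasDerivAt (hypPoint t)).comp t (hasDerivAt_hypPoint t)
  have h2 : (fun t => V.eval (hypPoint t)) = fun t => ∑ k ∈ s, b k * Real.cosh (k * t) := by
    ext t
    rw [hV, eval_finsetSum]
    simp [shiftedT_eval_hypPoint]
  rw [h2] at h1
  have h3 : HasDerivAt (fun t => ∑ k ∈ s, b k * Real.cosh (k * t))
      (∑ k ∈ s, k * b k * Real.sinh (k * t)) t := by
    refine HasDerivAt.fun_sum fun k _ => ?_
    have := (((hasDerivAt_id t).const_mul (k : ℝ)).cosh).const_mul (b k)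
    refine this.congr_deriv ?_
    simp only [id]
    ring
  exact h1.unique h3

lemma eq_zero_of_tendsto_hypPoint {P : ℝ[X]}
    (h : Filter.Tendsto (fun t => P.eval (hypPoint t)) Filter.atTop (nhds 0)) : P = 0 := by
  rcases le_or_gt P.degree 0 with hd | hd
  · rw [eq_C_of_degree_le_zero hd] at h ⊢
    simp only [eval_C] at h
    rw [tendsto_const_nhds_iff.1 h, C_0]
  · exfalso
    have h1 := (P.abs_tendsto_atTop hd).comp tendsto_hypPoint
    exact not_tendsto_nhds_of_tendsto_atTop h1 _ h.abs

/-- At `y = hypPoint t` the `W(y)` part of the averaged divided difference, times `y - 1`, is `√(y(y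
- 1)) V'(y) = ∑ k b_k sinh kt`. This differs from the Chebyshev sum by exponentials `e^{-kt}`, while
the other part is `-c + o(1)`. The two sides thus differ by a polynomial tending to zero at
infinity, which is zero. -/
theorem sub_one_mul_arcDividedDifference {V : ℝ[X]} {s : Finset ℕ} {b : ℕ → ℝ}
    (hV : V = ∑ k ∈ s, C (b k) * shiftedT k) :
    (X - 1) * arcDividedDifference (X * derivative V) =
      ∑ k ∈ s, C (k * b k) * shiftedT k -
        C ((1 / Real.pi) * ∫ θ in (0 : ℝ)..Real.pi, (X * derivative V).eval (arcPoint θ)) := by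
  set W : ℝ[X] := X * derivative V with hW
  set c : ℝ := (1 / Real.pi) * ∫ θ in (0 : ℝ)..Real.pi, W.eval (arcPoint θ) with hc
  rw [← sub_eq_zero]
  apply eq_zero_of_tendsto_hypPoint
  have hWc : Continuous fun θ => W.eval (arcPoint θ) := W.continuous.comp continuous_arcPoint
  have hac := continuous_arcPoint
  obtain ⟨M, hM⟩ : ∃ M, ∀ θ, |W.eval (arcPoint θ)| ≤ M := by
    obtain ⟨M, hM⟩ := isCompact_Icc.exists_bound_of_continuousOn
      (W.continuous.continuousOn (s := Set.Icc (0 : ℝ) 1))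
    exact ⟨M, fun θ => hM _ (arcPoint_mem_Icc θ)⟩
  have key : ∀ t : ℝ, 0 < t →
      ((X - 1) * arcDividedDifference W - (∑ k ∈ s, C (k * b k) * shiftedT k - C c)).eval
        (hypPoint t) = -(∑ k ∈ s, k * b k * Real.exp (-(k * t))) +
        (1 / Real.pi) * ∫ θ in (0 : ℝ)..Real.pi,
          W.eval (arcPoint θ) * ((1 - arcPoint θ) / (hypPoint t - arcPoint θ)) := by
    intro t ht
    have hy := one_lt_hypPoint ht
    have hprod := hypPoint_mul_sub_one t
    have hsinh : 0 < Real.sinh t := Real.sinh_pos_iff.2 ht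
    have hder := eval_derivative_mul_sinh hV t
    have hinv := integral_inv_sub_arcPoint hy
    rw [hprod, Real.sqrt_sq (by positivity)] at hinv
    have hdiv := eval_arcDividedDifference W hy
    have hne : ∀ θ, hypPoint t - arcPoint θ ≠ 0 := fun θ => by
      linarith [(arcPoint_mem_Icc θ).2]
    set y := hypPoint t with hydef
    have hI1 : IntervalIntegrable (fun θ => W.eval y * (y - arcPoint θ)⁻¹) volume 0 Real.pi :=
      (Continuous.mul continuous_const ((by fun_prop : Continuous fun θ => y - arcPoint θ).inv₀
        hne)).intervalIntegrable _ _
    have hI2 : IntervalIntegrable (fun θ => W.eval (arcPoint θ) / (y - arcPoint θ))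
        volume 0 Real.pi :=
      (hWc.div (by fun_prop) hne).intervalIntegrable _ _
    have e1 : ∫ θ in (0 : ℝ)..Real.pi, (W.eval y - W.eval (arcPoint θ)) / (y - arcPoint θ) =
        W.eval y * (∫ θ in (0 : ℝ)..Real.pi, (y - arcPoint θ)⁻¹) -
          ∫ θ in (0 : ℝ)..Real.pi, W.eval (arcPoint θ) / (y - arcPoint θ) := by
      rw [← intervalIntegral.integral_const_mul, ← intervalIntegral.integral_sub hI1 hI2]
      refine intervalIntegral.integral_congr fun θ _ => ?_
      ring
    -- From `(1 - s) / (y - s) = 1 - (y - 1) / (y - s)`: this isolates the mean `c` and leaves a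
    -- remainder of order `1 / (y - 1)`.
    have e2 : ∫ θ in (0 : ℝ)..Real.pi,
          W.eval (arcPoint θ) * ((1 - arcPoint θ) / (y - arcPoint θ)) =
        (∫ θ in (0 : ℝ)..Real.pi, W.eval (arcPoint θ)) -
          (y - 1) * ∫ θ in (0 : ℝ)..Real.pi, W.eval (arcPoint θ) / (y - arcPoint θ) := by
      rw [← intervalIntegral.integral_const_mul, ← intervalIntegral.integral_sub
        (hWc.intervalIntegrable _ _) (hI2.const_mul _)]
      refine intervalIntegral.integral_congr fun θ _ => ?_
      have := hne θ
      field_simp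
      ring
    have hcosh : ∑ k ∈ s, k * b k * Real.cosh (k * t) =
        ∑ k ∈ s, k * b k * Real.sinh (k * t) + ∑ k ∈ s, k * b k * Real.exp (-(k * t)) := by
      rw [← Finset.sum_add_distrib]
      refine Finset.sum_congr rfl fun k _ => ?_
      rw [← Real.cosh_sub_sinh]
      ring
    have hWy : W.eval y = y * (derivative V).eval y := by simp [hW]
    simp only [eval_sub, eval_mul, eval_X, eval_one, eval_finsetSum, eval_C]
    simp only [hydef, shiftedT_eval_hypPoint]
    simp only [← hydef]
    rw [hcosh, ← hder, hdiv, e1, e2, hc, hWy]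
    generalize (∫ θ in (0 : ℝ)..Real.pi, (y - arcPoint θ)⁻¹) = I1 at *
    have h6 : y * (y - 1) * (1 / Real.pi * I1) = Real.sinh t / 2 := by
      rw [hinv, hprod]
      field_simp
    linear_combination (derivative V).eval y * h6
  have hlim1 : Filter.Tendsto (fun t : ℝ => -(∑ k ∈ s, k * b k * Real.exp (-(k * t))))
      Filter.atTop (nhds 0) := by
    have : Filter.Tendsto (fun t : ℝ => ∑ k ∈ s, k * b k * Real.exp (-(k * t)))
        Filter.atTop (nhds (∑ k ∈ s, (0 : ℝ))) := by
      refine tendsto_finsetSum _ fun k _ => ?_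
      rcases Nat.eq_zero_or_pos k with rfl | hk
      · simp
      · have hk' : (0 : ℝ) < k := by exact_mod_cast hk
        have h1 : Filter.Tendsto (fun t : ℝ => Real.exp (-(k * t))) Filter.atTop (nhds 0) :=
          Real.tendsto_exp_neg_atTop_nhds_zero.comp
            (Filter.tendsto_id.const_mul_atTop hk')
        simpa using h1.const_mul ((k : ℝ) * b k)
    simpa using this.neg
  have hlim2 : Filter.Tendsto (fun t : ℝ => (1 / Real.pi) * ∫ θ in (0 : ℝ)..Real.pi,
          W.eval (arcPoint θ) * ((1 - arcPoint θ) / (hypPoint t - arcPoint θ)))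
      Filter.atTop (nhds 0) := by
    have h0 : Filter.Tendsto (fun t : ℝ => (1 / Real.pi) * (M * (1 / (hypPoint t - 1)) * Real.pi))
        Filter.atTop (nhds ((1 / Real.pi) * (M * 0 * Real.pi))) := by
      refine Filter.Tendsto.const_mul _ (Filter.Tendsto.mul_const _ (Filter.Tendsto.const_mul _ ?_))
      exact Filter.Tendsto.div_atTop tendsto_const_nhds
        (Filter.tendsto_atTop_add_const_right _ _ tendsto_hypPoint)
    simp only [mul_zero, zero_mul] at h0
    refine squeeze_zero_norm' ?_ h0
    filter_upwards [Filter.eventually_gt_atTop 0] with t ht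
    have hy := one_lt_hypPoint ht
    have hpi := Real.pi_pos
    rw [norm_mul, Real.norm_of_nonneg (by positivity : 0 ≤ 1 / Real.pi)]
    refine mul_le_mul_of_nonneg_left ?_ (by positivity)
    have := intervalIntegral.norm_integral_le_of_norm_le_const (a := 0) (b := Real.pi)
      (f := fun θ => W.eval (arcPoint θ) * ((1 - arcPoint θ) / (hypPoint t - arcPoint θ)))
      (C := M * (1 / (hypPoint t - 1))) ?_
    · simpa [abs_of_pos hpi] using this
    · intro θ _
      have h1 := arcPoint_mem_Icc θ
      have h2 : 0 < hypPoint t - arcPoint θ := by linarith [h1.2]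
      rw [norm_mul]
      refine mul_le_mul (hM θ) ?_ (norm_nonneg _) ((abs_nonneg _).trans (hM θ))
      rw [Real.norm_of_nonneg (div_nonneg (by linarith [h1.2]) h2.le)]
      exact div_le_div₀ zero_le_one (by linarith [h1.1]) (by linarith) (by linarith [h1.2])
  have hsum := hlim1.add hlim2
  rw [add_zero] at hsum
  refine hsum.congr' ?_
  filter_upwards [Filter.eventually_gt_atTop 0] with t ht
  exact (key t ht).symm

/-! ### The logarithmic potential of the density -/

section Potential

/-- The constant 2 in `hh` is the arcsine mean of `x V'(x)` fixed by the MRS condition. The `k = 0`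
term of the sum vanishes, so the cosine polynomial has constant term `1 / π` and mass one. -/
lemma angularDensity_eq {h : ℝ[X]} {s : Finset ℕ} {b : ℕ → ℝ}
    (hh : (X - 1) * h = ∑ k ∈ s, C (k * b k) * shiftedT k - C 2) (θ : ℝ) :
    angularDensity h θ = (1 / (2 * Real.pi)) * (2 - ∑ k ∈ s, k * b k * Real.cos (k * θ)) := by
  have h1 := congrArg (eval (arcPoint θ)) hh
  simp only [eval_sub, eval_mul, eval_X, eval_one, eval_finsetSum, eval_C,
    shiftedT_eval_arcPoint] at h1
  unfold angularDensity
  linear_combination (-(1 / (2 * Real.pi))) * h1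

lemma integral_angularDensity {h : ℝ[X]} {s : Finset ℕ} {b : ℕ → ℝ}
    (hh : (X - 1) * h = ∑ k ∈ s, C (k * b k) * shiftedT k - C 2) :
    ∫ θ in (0 : ℝ)..Real.pi, angularDensity h θ = 1 := by
  have hint : ∀ k : ℕ, IntervalIntegrable (fun θ : ℝ => k * b k * Real.cos (k * θ)) volume 0
      Real.pi := fun k => Continuous.intervalIntegrable (by fun_prop) _ _
  simp_rw [angularDensity_eq hh]
  rw [intervalIntegral.integral_const_mul, intervalIntegral.integral_sub intervalIntegrable_const
    (Continuous.intervalIntegrable (by fun_prop) _ _),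
    intervalIntegral.integral_finsetSum fun k _ => hint k]
  have h0 : ∀ k ∈ s, ∫ θ in (0 : ℝ)..Real.pi, k * b k * Real.cos (k * θ) = 0 := by
    intro k _
    rw [intervalIntegral.integral_const_mul]
    rcases Nat.eq_zero_or_pos k with rfl | hk
    · simp
    · rw [integral_cos_nat_mul hk.ne', mul_zero]
  rw [Finset.sum_eq_zero h0]
  have := Real.pi_pos.ne'
  simp
  field_simp

lemma intervalIntegrable_log_mul_angularDensity (h : ℝ[X]) {w : ℂ} (hw : w ≠ 0) {x : ℝ}
    (hx : (x : ℂ) = (2 + w + w⁻¹) / 4) :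
    IntervalIntegrable (fun θ => Real.log |x - arcPoint θ| * angularDensity h θ) volume 0
      Real.pi :=
  (intervalIntegrable_log_abs_sub_arcPoint hw hx).mul_continuousOn
    (continuous_angularDensity h).continuousOn

/-- The logarithmic potential of the equilibrium density in the Joukowski coordinate. -/
theorem integral_log_mul_equilibriumDensity {h : ℝ[X]} {s : Finset ℕ} {b : ℕ → ℝ}
    (hh : (X - 1) * h = ∑ k ∈ s, C (k * b k) * shiftedT k - C 2) {w : ℂ} (hw : 1 ≤ ‖w‖) {x : ℝ}
    (hx : (x : ℂ) = (2 + w + w⁻¹) / 4) :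
    ∫ y, Real.log |x - y| * equilibriumDensity h y = Real.log ‖w‖ - Real.log 4 +
      (1 / 2) * (∑ k ∈ s, b k * ((w⁻¹) ^ k).re - ∑ k ∈ s, if k = 0 then b k else 0) := by
  have hw0 : w ≠ 0 := by rintro rfl; norm_num at hw
  have hlog := intervalIntegrable_log_abs_sub_arcPoint hw0 hx
  rw [integral_mul_equilibriumDensity (fun y => Real.log |x - y|)]
  have e : ∀ θ : ℝ, Real.log |x - arcPoint θ| * angularDensity h θ = (1 / (2 * Real.pi)) *
      (Real.log |x - arcPoint θ| * 2 -
        ∑ k ∈ s, k * b k * (Real.log |x - arcPoint θ| * Real.cos (k * θ))) := by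
    intro θ
    rw [angularDensity_eq hh]
    have : ∑ k ∈ s, k * b k * (Real.log |x - arcPoint θ| * Real.cos (k * θ)) =
        Real.log |x - arcPoint θ| * ∑ k ∈ s, k * b k * Real.cos (k * θ) := by
      rw [Finset.mul_sum]
      exact Finset.sum_congr rfl fun k _ => by ring
    rw [this]
    ring
  have hint : ∀ k : ℕ, IntervalIntegrable (fun θ : ℝ =>
      k * b k * (Real.log |x - arcPoint θ| * Real.cos (k * θ))) volume 0 Real.pi := fun k =>
    (hlog.mul_continuousOn (g := fun θ : ℝ => Real.cos (k * θ)) (by fun_prop)).const_mul _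
  have hsum : IntervalIntegrable (fun θ : ℝ =>
      ∑ k ∈ s, k * b k * (Real.log |x - arcPoint θ| * Real.cos (k * θ))) volume 0 Real.pi := by
    have := IntervalIntegrable.sum s (f := fun (k : ℕ) (θ : ℝ) =>
      k * b k * (Real.log |x - arcPoint θ| * Real.cos (k * θ))) (fun k _ => hint k)
    refine this.congr (fun θ _ => ?_)
    simp
  simp_rw [e]
  rw [intervalIntegral.integral_const_mul, intervalIntegral.integral_sub (hlog.mul_const 2) hsum,
    intervalIntegral.integral_finsetSum fun k _ => hint k,
    intervalIntegral.integral_mul_const, integral_log_abs_sub_arcPoint hw hx]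
  -- The factor `k` of the density cancels the `1 / k` of the logarithmic integral. At `k = 0` the
  -- left side is zero, hence the subtracted `b 0`.
  have h0 : ∀ k ∈ s, ∫ θ in (0 : ℝ)..Real.pi,
      k * b k * (Real.log |x - arcPoint θ| * Real.cos (k * θ)) =
      -Real.pi * (b k * ((w⁻¹) ^ k).re - if k = 0 then b k else 0) := by
    intro k _
    rw [intervalIntegral.integral_const_mul]
    rcases Nat.eq_zero_or_pos k with rfl | hk
    · simp
    · rw [integral_log_abs_sub_arcPoint_mul_cos hw hx hk.ne', if_neg hk.ne']
      have : (k : ℝ) ≠ 0 := by exact_mod_cast hk.ne'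
      field_simp
      ring
  rw [Finset.sum_congr rfl h0, ← Finset.mul_sum, Finset.sum_sub_distrib]
  have := Real.pi_pos.ne'
  field_simp
  ring

lemma exists_joukowski {x : ℝ} (hx : 0 ≤ x) :
    ∃ w : ℂ, 1 ≤ ‖w‖ ∧ (x : ℂ) = (2 + w + w⁻¹) / 4 := by
  rcases le_or_gt x 1 with h | h
  · obtain ⟨φ, rfl⟩ := exists_arcPoint_eq ⟨hx, h⟩
    exact ⟨_, by rw [Complex.norm_exp_ofReal_mul_I], joukowski_of_mem_Icc φ⟩
  · obtain ⟨t, ht, rfl⟩ := exists_hypPoint_eq h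
    refine ⟨_, ?_, joukowski_of_one_le t⟩
    rw [Complex.norm_real, Real.norm_of_nonneg (Real.exp_pos _).le]
    exact Real.one_le_exp ht.le

theorem integrable_log_mul_equilibriumDensity (h : ℝ[X]) {x : ℝ} (hx : 0 ≤ x) :
    Integrable fun y => Real.log |x - y| * equilibriumDensity h y := by
  obtain ⟨w, hw, hxw⟩ := exists_joukowski hx
  have hw0 : w ≠ 0 := by rintro rfl; norm_num at hw
  exact (integrable_mul_equilibriumDensity_iff (fun y => Real.log |x - y|) h).2
    (intervalIntegrable_log_mul_angularDensity h hw0 hxw)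

/-- Here `log ‖w‖ ≥ 0` and `|w^{-k}| ≤ 1`. Together with an upper bound on the logarithm, this
controls the integral of its absolute value. -/
lemma potential_lower_bound {h : ℝ[X]} {s : Finset ℕ} {b : ℕ → ℝ}
    (hh : (X - 1) * h = ∑ k ∈ s, C (k * b k) * shiftedT k - C 2) :
    ∃ B : ℝ, ∀ x : ℝ, 0 ≤ x → -B ≤ ∫ y, Real.log |x - y| * equilibriumDensity h y := by
  refine ⟨Real.log 4 + (1 / 2) * (∑ k ∈ s, |b k| + ∑ k ∈ s, if k = 0 then b k else 0),
    fun x hx => ?_⟩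
  obtain ⟨w, hw, hxw⟩ := exists_joukowski hx
  rw [integral_log_mul_equilibriumDensity hh hw hxw]
  have h1 := Real.log_nonneg hw
  have h2 : -(∑ k ∈ s, |b k|) ≤ ∑ k ∈ s, b k * ((w⁻¹) ^ k).re := by
    rw [← Finset.sum_neg_distrib]
    refine Finset.sum_le_sum fun k _ => ?_
    have h3 : |b k * ((w⁻¹) ^ k).re| ≤ |b k| := by
      rw [abs_mul]
      refine mul_le_of_le_one_right (abs_nonneg _) ((Complex.abs_re_le_norm _).trans ?_)
      rw [norm_pow, norm_inv]
      exact pow_le_one₀ (by positivity) (inv_le_one_of_one_le₀ hw)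
    exact (neg_le_neg h3).trans (neg_abs_le _)
  linarith

variable {V h : ℝ[X]} {s : Finset ℕ} {b : ℕ → ℝ}

/-- On `[0, 1]` one has `w = e^{iφ}`, so `log ‖w‖ = 0` and `Re w^{-k} = cos kφ`: the sum in the
potential is `V(x)` itself. -/
theorem potential_eq_on_Icc (hV : V = ∑ k ∈ s, C (b k) * shiftedT k)
    (hh : (X - 1) * h = ∑ k ∈ s, C (k * b k) * shiftedT k - C 2) {x : ℝ}
    (hx : x ∈ Set.Icc (0 : ℝ) 1) :
    2 * (∫ y, Real.log |x - y| * equilibriumDensity h y) - V.eval x -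
      (-2 * Real.log 4 - ∑ k ∈ s, if k = 0 then b k else 0) = 0 := by
  obtain ⟨φ, rfl⟩ := exists_arcPoint_eq hx
  rw [integral_log_mul_equilibriumDensity hh (by rw [Complex.norm_exp_ofReal_mul_I])
    (joukowski_of_mem_Icc φ), Complex.norm_exp_ofReal_mul_I, Real.log_one]
  have h1 : V.eval (arcPoint φ) = ∑ k ∈ s, b k * Real.cos (k * φ) := by
    rw [hV, eval_finsetSum]
    simp [shiftedT_eval_arcPoint]
  have h2 : ∀ k : ℕ, (((Complex.exp (φ * Complex.I))⁻¹) ^ k).re = Real.cos (k * φ) := by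
    intro k
    rw [← Complex.exp_neg, ← Complex.exp_nat_mul]
    have : (k : ℂ) * -(φ * Complex.I) = ((-(k * φ) : ℝ) : ℂ) * Complex.I := by push_cast; ring
    rw [this, Complex.exp_ofReal_mul_I_re, Real.cos_neg]
  simp_rw [h2]
  rw [h1]
  ring

/-- With `w = e^t` and `cosh - exp(-·) = sinh`, the expression equals `2t - ∑ b_k sinh kt`, which is
zero at `t = 0`. -/
theorem potential_lt_on_Ioi (hV : V = ∑ k ∈ s, C (b k) * shiftedT k)
    (hh : (X - 1) * h = ∑ k ∈ s, C (k * b k) * shiftedT k - C 2)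
    (hpos : ∀ x : ℝ, 0 ≤ x → 0 < h.eval x) {x : ℝ} (hx : 1 < x) :
    2 * (∫ y, Real.log |x - y| * equilibriumDensity h y) - V.eval x -
      (-2 * Real.log 4 - ∑ k ∈ s, if k = 0 then b k else 0) < 0 := by
  obtain ⟨t, ht, rfl⟩ := exists_hypPoint_eq hx
  have hnorm : ‖(Real.exp t : ℂ)‖ = Real.exp t := by
    rw [Complex.norm_real, Real.norm_of_nonneg (Real.exp_pos _).le]
  rw [integral_log_mul_equilibriumDensity hh (by rw [hnorm]; exact Real.one_le_exp ht.le)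
    (joukowski_of_one_le t), hnorm, Real.log_exp]
  have h1 : V.eval (hypPoint t) = ∑ k ∈ s, b k * Real.cosh (k * t) := by
    rw [hV, eval_finsetSum]
    simp [shiftedT_eval_hypPoint]
  have h2 : ∀ k : ℕ, (((Real.exp t : ℂ)⁻¹) ^ k).re = Real.exp (-(k * t)) := by
    intro k
    rw [← Complex.ofReal_inv, ← Complex.ofReal_pow, Complex.ofReal_re, ← Real.exp_neg,
      ← Real.exp_nat_mul]
    ring_nf
  simp_rw [h2]
  have h3 : ∑ k ∈ s, b k * Real.cosh (k * t) =
      ∑ k ∈ s, b k * Real.sinh (k * t) + ∑ k ∈ s, b k * Real.exp (-(k * t)) := by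
    rw [← Finset.sum_add_distrib]
    refine Finset.sum_congr rfl fun k _ => ?_
    rw [← Real.cosh_sub_sinh]
    ring
  have hder : ∀ t, HasDerivAt (fun t => 2 * t - ∑ k ∈ s, b k * Real.sinh (k * t))
      (2 - ∑ k ∈ s, k * b k * Real.cosh (k * t)) t := by
    intro t
    refine HasDerivAt.sub (by simpa using (hasDerivAt_id t).const_mul 2) ?_
    refine HasDerivAt.fun_sum fun k _ => ?_
    have := (((hasDerivAt_id t).const_mul (k : ℝ)).sinh).const_mul (b k)
    refine this.congr_deriv ?_
    simp only [id]
    ring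
  have hanti : StrictAntiOn (fun t => 2 * t - ∑ k ∈ s, b k * Real.sinh (k * t)) (Set.Ici 0) := by
    refine strictAntiOn_of_deriv_neg (convex_Ici 0)
      (fun t _ => (hder t).continuousAt.continuousWithinAt) fun t ht => ?_
    rw [interior_Ici] at ht
    rw [(hder t).deriv]
    -- By `hh` the derivative is `-(x - 1) h(x)` at `x = hypPoint t > 1`, where positivity of `h`
    -- applies.
    have h4 := congrArg (eval (hypPoint t)) hh
    simp only [eval_sub, eval_mul, eval_X, eval_one, eval_finsetSum, eval_C,
      shiftedT_eval_hypPoint] at h4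
    have h5 := one_lt_hypPoint ht
    have h6 := mul_pos (sub_pos.2 h5) (hpos (hypPoint t) (by linarith))
    linarith
  have h7 := hanti (Set.self_mem_Ici) (Set.mem_Ici.2 ht.le) ht
  simp at h7
  rw [h1, h3]
  linarith

end Potential

/-! ### The density defines the equilibrium measure -/

lemma exists_log_le_polynomial {V : ℝ[X]} (hd : 1 ≤ V.natDegree) (hl : 0 < V.leadingCoeff) :
    ∃ K : ℝ, ∀ t : ℝ, 0 ≤ t → 4 * Real.log (1 + t) ≤ V.eval t + K := by
  have hdeg : (X : ℝ[X]).degree ≤ V.degree := by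
    rw [degree_X]
    exact Nat.WithBot.one_le_iff_zero_lt.2 (natDegree_pos_iff_degree_pos.1 hd)
  have hdpos : 0 < V.degree := natDegree_pos_iff_degree_pos.1 hd
  have h1 : (fun t : ℝ => 4 * Real.log (1 + t)) =o[Filter.atTop] fun t => V.eval t := by
    have h2 : (fun t : ℝ => Real.log (1 + t)) =o[Filter.atTop] fun t : ℝ => 1 + t :=
      Real.isLittleO_log_id_atTop.comp_tendsto
        (Filter.tendsto_atTop_add_const_left _ 1 Filter.tendsto_id)
    have h3 : (fun t : ℝ => 1 + t) =O[Filter.atTop] fun t => V.eval t := by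
      have := Polynomial.isBigO_atTop_of_degree_le (1 + X) V (by
        refine le_trans ?_ hdeg
        rw [add_comm, ← C_1, degree_X_add_C, degree_X])
      simpa using this
    exact (h2.trans_isBigO h3).const_mul_left 4
  have h4 := V.tendsto_atTop_of_leadingCoeff_nonneg hdpos hl.le
  have h5 : ∀ᶠ t in Filter.atTop, 4 * Real.log (1 + t) ≤ V.eval t := by
    filter_upwards [h1.bound one_pos, h4.eventually_ge_atTop 0] with t ht1 ht2
    rw [one_mul, Real.norm_of_nonneg ht2] at ht1
    exact (le_abs_self _).trans ht1
  obtain ⟨M, hM⟩ := Filter.eventually_atTop.1 h5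
  have hc : ContinuousOn (fun t : ℝ => 4 * Real.log (1 + t) - V.eval t) (Set.Icc 0 M) := by
    refine ContinuousOn.sub (ContinuousOn.mul continuousOn_const
      (ContinuousOn.log (by fun_prop) fun t ht => ?_)) V.continuous.continuousOn
    linarith [ht.1]
  obtain ⟨K, hK⟩ := (isCompact_Icc.image_of_continuousOn hc).bddAbove
  refine ⟨max K 0, fun t ht => ?_⟩
  rcases le_total t M with h | h
  · have := hK ⟨t, ⟨ht, h⟩, rfl⟩
    simp only at this
    linarith [le_max_left K 0]
  · linarith [hM t h, le_max_right K 0]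

lemma equilibriumDensity_nonneg {h : ℝ[X]} (hpos : ∀ x : ℝ, 0 ≤ x → 0 < h.eval x) (x : ℝ) :
    0 ≤ equilibriumDensity h x := by
  refine Set.indicator_nonneg (fun y hy => ?_) x
  have := (hpos y hy.1.le).le
  have := Real.pi_pos
  positivity

lemma measurable_equilibriumDensity (h : ℝ[X]) : Measurable (equilibriumDensity h) := by
  have := h.continuous.measurable
  refine Measurable.indicator ?_ measurableSet_Ioc
  fun_prop

theorem integrable_equilibriumDensity (h : ℝ[X]) : Integrable (equilibriumDensity h) := by
  have := (integrable_mul_equilibriumDensity_iff (fun _ => 1) h).2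
    (by simpa using (continuous_angularDensity h).intervalIntegrable _ _)
  simpa using this

theorem integral_equilibriumDensity {h : ℝ[X]} {s : Finset ℕ} {b : ℕ → ℝ}
    (hh : (X - 1) * h = ∑ k ∈ s, C (k * b k) * shiftedT k - C 2) :
    ∫ y, equilibriumDensity h y = 1 := by
  have := integral_mul_equilibriumDensity (fun _ => 1) h
  simpa [integral_angularDensity hh] using this

section Equilibrium

variable {V h : ℝ[X]} {s : Finset ℕ} {b : ℕ → ℝ}

theorem isEquilibriumMeasure_withDensity (hd : 1 ≤ V.natDegree) (hl : 0 < V.leadingCoeff)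
    (hV : V = ∑ k ∈ s, C (b k) * shiftedT k)
    (hh : (X - 1) * h = ∑ k ∈ s, C (k * b k) * shiftedT k - C 2)
    (hpos : ∀ x : ℝ, 0 ≤ x → 0 < h.eval x) :
    IsEquilibriumMeasure (Set.Ici 0) (fun x => V.eval x)
      (volume.withDensity fun x => ENNReal.ofReal (equilibriumDensity h x)) := by
  set ψ := equilibriumDensity h with hψ
  set μ : Measure ℝ := volume.withDensity fun x => ENNReal.ofReal (ψ x) with hμ
  have hnn : ∀ x, 0 ≤ ψ x := equilibriumDensity_nonneg hpos
  have hm : Measurable fun x => ENNReal.ofReal (ψ x) :=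
    (measurable_equilibriumDensity h).ennreal_ofReal
  have hfin : ∀ᵐ x : ℝ, ENNReal.ofReal (ψ x) < ⊤ :=
    Filter.Eventually.of_forall fun x => ENNReal.ofReal_lt_top
  have hprob : IsProbabilityMeasure μ := by
    constructor
    rw [hμ, withDensity_apply _ MeasurableSet.univ, Measure.restrict_univ,
      ← ofReal_integral_eq_lintegral_ofReal (integrable_equilibriumDensity h)
        (Filter.Eventually.of_forall hnn), integral_equilibriumDensity hh, ENNReal.ofReal_one]
  have hsupp : ∀ᵐ x ∂μ, x ∈ Set.Icc (0 : ℝ) 1 := by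
    rw [hμ, ae_withDensity_iff hm]
    refine Filter.Eventually.of_forall fun x hx => ?_
    by_contra hcon
    apply hx
    have : x ∉ Set.Ioc (0 : ℝ) 1 := fun h => hcon (Set.Ioc_subset_Icc_self h)
    simp [hψ, equilibriumDensity, this]
  have hint : ∀ f : ℝ → ℝ, ∫ x, f x ∂μ = ∫ x, f x * ψ x := by
    intro f
    rw [hμ, integral_withDensity_eq_integral_toReal_smul hm hfin]
    refine integral_congr_ae (Filter.Eventually.of_forall fun x => ?_)
    simp only [smul_eq_mul, ENNReal.toReal_ofReal (hnn x)]
    ring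
  have hintble : ∀ f : ℝ → ℝ, Integrable f μ ↔ Integrable fun x => f x * ψ x := by
    intro f
    rw [hμ, integrable_withDensity_iff hm hfin]
    refine integrable_congr (Filter.Eventually.of_forall fun x => ?_)
    simp only [ENNReal.toReal_ofReal (hnn x)]
  have hlogint : ∀ x, 0 ≤ x → Integrable (fun y => Real.log |x - y|) μ := fun x hx =>
    (hintble _).2 (integrable_log_mul_equilibriumDensity h hx)
  obtain ⟨K, hK⟩ := exists_log_le_polynomial hd hl
  obtain ⟨B, hB⟩ := potential_lower_bound hh
  refine isEquilibriumMeasure_of_variational (C := K) (B := B)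
    (ℓ := -2 * Real.log 4 - ∑ k ∈ s, if k = 0 then b k else 0) V.continuous hK ?_ ?_ hlogint
    ?_ ?_ ?_
  · have : ∀ᵐ x ∂μ, x ∈ Set.Ici (0 : ℝ) := by
      filter_upwards [hsupp] with x hx using hx.1
    exact ae_iff.1 this
  · rw [hintble]
    refine (integrable_mul_equilibriumDensity_iff _ h).2 ?_
    exact ((V.continuous.comp continuous_arcPoint).mul
      (continuous_angularDensity h)).intervalIntegrable _ _
  · intro x hx
    -- If `u ≤ L` and `0 ≤ L`, then `|u| ≤ 2L - u`; with `L = log (1 + x)`, a lower bound on the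
    -- potential suffices.
    have h1 : ∫ y, |Real.log (|x - y|)| ∂μ ≤ ∫ y, (2 * Real.log (1 + x) - Real.log |x - y|) ∂μ := by
      refine integral_mono_ae (hlogint x hx).abs ((integrable_const _).sub (hlogint x hx)) ?_
      filter_upwards [hsupp] with y hy
      have h2 : Real.log |x - y| ≤ Real.log (1 + x) := by
        rcases eq_or_ne (x - y) 0 with h0 | h0
        · rw [h0, abs_zero, Real.log_zero]
          exact Real.log_nonneg (by linarith)
        · refine Real.log_le_log (abs_pos.2 h0) ?_
          rw [abs_le]
          constructor <;> linarith [hy.1, hy.2]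
      have h3 : 0 ≤ Real.log (1 + x) := Real.log_nonneg (by linarith)
      rw [abs_le]
      constructor <;> linarith
    refine h1.trans ?_
    rw [integral_sub (integrable_const _) (hlogint x hx), hint (fun y => Real.log |x - y|)]
    have := hB x hx
    simp only [integral_const, probReal_univ, smul_eq_mul, one_mul]
    linarith
  · intro x hx
    rw [hint (fun y => Real.log |x - y|)]
    rcases le_or_gt x 1 with h1 | h1
    · linarith [potential_eq_on_Icc hV hh ⟨hx, h1⟩]
    · linarith [potential_lt_on_Ioi hV hh hpos h1]
  · filter_upwards [hsupp] with x hx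
    rw [hint (fun y => Real.log |x - y|)]
    linarith [potential_eq_on_Icc hV hh hx]

end Equilibrium

/-! ### MRS numbers and the uniform lower bound for `h` -/

lemma exists_strictMonoOn_Ici {P : ℝ[X]} (hd : 1 ≤ P.natDegree) (hl : 0 < P.leadingCoeff) :
    ∃ M : ℝ, StrictMonoOn (fun x => P.eval x) (Set.Ici M) := by
  have hc : (derivative P).coeff (P.natDegree - 1) = P.leadingCoeff * P.natDegree := by
    rw [coeff_derivative, Nat.sub_add_cancel hd, leadingCoeff]
    congr 1
    rw [Nat.cast_sub hd]
    simp
  have hcpos : 0 < (derivative P).coeff (P.natDegree - 1) := by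
    rw [hc]
    have : (0 : ℝ) < P.natDegree := by exact_mod_cast hd
    positivity
  have hnd : (derivative P).natDegree = P.natDegree - 1 :=
    natDegree_eq_of_le_of_coeff_ne_zero (natDegree_derivative_le P) hcpos.ne'
  have hl' : 0 < (derivative P).leadingCoeff := by rwa [leadingCoeff, hnd]
  have hev : ∀ᶠ x in Filter.atTop, 0 < (derivative P).eval x := by
    rcases le_or_gt (derivative P).degree 0 with h | h
    · rw [eq_C_of_degree_le_zero h] at hl' ⊢
      rw [leadingCoeff_C] at hl'
      simp only [eval_C]
      exact Filter.Eventually.of_forall fun _ => hl'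
    · exact (tendsto_atTop_of_leadingCoeff_nonneg _ h hl'.le).eventually_gt_atTop 0
  obtain ⟨M, hM⟩ := Filter.eventually_atTop.1 hev
  refine ⟨M, strictMonoOn_of_deriv_pos (convex_Ici M) P.continuous.continuousOn fun x hx => ?_⟩
  rw [interior_Ici] at hx
  rw [Polynomial.deriv]
  exact hM x (le_of_lt hx)

/-- A nonconstant real polynomial with positive leading coefficient takes each large value at
exactly one positive point, and that point is large. -/
lemma exists_unique_pos_eval_eq {P : ℝ[X]} (hd : 1 ≤ P.natDegree) (hl : 0 < P.leadingCoeff)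
    (M₀ : ℝ) : ∃ N : ℝ, ∀ a : ℝ, N < a → (∃! β : ℝ, 0 < β ∧ P.eval β = a) ∧
      ∀ β : ℝ, 0 < β → P.eval β = a → M₀ < β := by
  obtain ⟨M₁, hM₁⟩ := exists_strictMonoOn_Ici hd hl
  set M := max (max M₀ M₁) 0 with hM
  have hM0 : 0 ≤ M := le_max_right _ _
  have hmono : StrictMonoOn (fun x => P.eval x) (Set.Ici M) :=
    hM₁.mono (Set.Ici_subset_Ici.2 ((le_max_right _ _).trans (le_max_left _ _)))
  -- `N` bounds `P` on `[0, M]`, so values above `N` are attained on the positive axis only beyond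
  -- `M`, where `P` is strictly increasing.
  obtain ⟨N, hN⟩ := (isCompact_Icc.image_of_continuousOn
    (P.continuous.continuousOn (s := Set.Icc 0 M))).bddAbove
  have hlarge : ∀ a : ℝ, N < a → ∀ β : ℝ, 0 < β → P.eval β = a → M < β := by
    intro a ha β hβ hβa
    by_contra! hcon
    have := hN ⟨β, ⟨hβ.le, hcon⟩, rfl⟩
    simp only [hβa] at this
    linarith
  refine ⟨N, fun a ha => ⟨?_, fun β hβ hβa => ?_⟩⟩
  · have htend := P.tendsto_atTop_of_leadingCoeff_nonneg (natDegree_pos_iff_degree_pos.1 hd) hl.le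
    obtain ⟨x₁, hx₁, hMx⟩ :=
      ((htend.eventually_ge_atTop a).and (Filter.eventually_ge_atTop M)).exists
    have hMa : P.eval M ≤ a := (hN ⟨M, ⟨hM0, le_rfl⟩, rfl⟩).trans ha.le
    obtain ⟨β, hβ, hβa⟩ := intermediate_value_Icc hMx P.continuous.continuousOn ⟨hMa, hx₁⟩
    have hβ0 : 0 < β := by
      refine lt_of_le_of_ne (hM0.trans hβ.1) fun h0 => ?_
      have hM' : M = 0 := le_antisymm (h0 ▸ hβ.1) hM0
      have := hN ⟨β, ⟨(hM0.trans hβ.1), by rw [hM', ← h0]⟩, rfl⟩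
      simp only [] at this hβa
      linarith
    refine ⟨β, ⟨hβ0, hβa⟩, fun γ hγ => ?_⟩
    exact hmono.injOn (hlarge a ha γ hγ.1 hγ.2).le (hlarge a ha β hβ0 hβa).le
      (hγ.2.trans hβa.symm)
  · exact ((le_max_left _ _).trans (le_max_left _ _)).trans_lt (hlarge a ha β hβ hβa)

lemma coeff_X_mul_derivative (Q : ℝ[X]) (k : ℕ) :
    (X * derivative Q).coeff k = k * Q.coeff k := by
  cases k with
  | zero => simp
  | succ k => rw [coeff_X_mul, coeff_derivative]; push_cast; ring

lemma natDegree_X_mul_derivative_le (Q : ℝ[X]) : (X * derivative Q).natDegree ≤ Q.natDegree := by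
  rw [natDegree_le_iff_coeff_eq_zero]
  intro k hk
  rw [coeff_X_mul_derivative, coeff_eq_zero_of_natDegree_lt hk, mul_zero]

/-- The left-hand side of the Mhaskar-Rakhmanov-Saff equation, as a polynomial. -/
noncomputable def mrsPolynomial (Q : ℝ[X]) : ℝ[X] :=
  ∑ k ∈ Finset.range (Q.natDegree + 1), C (1 / 2 * (k * Q.coeff k * arcMoment k)) * X ^ k

lemma coeff_mrsPolynomial (Q : ℝ[X]) (j : ℕ) :
    (mrsPolynomial Q).coeff j =
      if j < Q.natDegree + 1 then 1 / 2 * (j * Q.coeff j * arcMoment j) else 0 := by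
  simp only [mrsPolynomial, finsetSum_coeff, coeff_C_mul, coeff_X_pow, mul_ite, mul_one, mul_zero,
    Finset.sum_ite_eq, Finset.mem_range]

lemma integral_X_mul_derivative_eval (Q : ℝ[X]) (β : ℝ) :
    ∫ θ in (0 : ℝ)..Real.pi, (X * derivative Q).eval (β * arcPoint θ) =
      2 * Real.pi * (mrsPolynomial Q).eval β := by
  have hac := continuous_arcPoint
  have e : ∀ θ : ℝ, (X * derivative Q).eval (β * arcPoint θ) =
      ∑ k ∈ Finset.range (Q.natDegree + 1), k * Q.coeff k * β ^ k * arcPoint θ ^ k := by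
    intro θ
    rw [eval_eq_sum_range' (Nat.lt_succ_of_le (natDegree_X_mul_derivative_le Q))]
    refine Finset.sum_congr rfl fun k _ => ?_
    rw [coeff_X_mul_derivative, mul_pow]
    ring
  have hint : ∀ k : ℕ, IntervalIntegrable (fun θ => k * Q.coeff k * β ^ k * arcPoint θ ^ k)
      volume 0 Real.pi := fun k => Continuous.intervalIntegrable (by fun_prop) _ _
  simp_rw [e]
  rw [intervalIntegral.integral_finsetSum fun k _ => hint k, mrsPolynomial, eval_finsetSum,
    Finset.mul_sum]
  refine Finset.sum_congr rfl fun k _ => ?_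
  rw [intervalIntegral.integral_const_mul, integral_arcPoint_pow]
  simp only [eval_mul, eval_C, eval_pow, eval_X]
  ring

lemma isMRSNumber_iff (Q : ℝ[X]) (n : ℕ) (β : ℝ) :
    IsMRSNumber Q n β ↔ 0 < β ∧ (mrsPolynomial Q).eval β = n := by
  unfold IsMRSNumber
  refine and_congr_right fun hβ => ?_
  have h := integral_X_mul_derivative_eval Q β
  simp only [eval_mul, eval_X] at h
  have := Real.pi_pos.ne'
  rw [integral_mul_sqrt_eq (fun x => (derivative Q).eval x) hβ, h]
  have e : 1 / (2 * Real.pi) * (2 * Real.pi * (mrsPolynomial Q).eval β) =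
      (mrsPolynomial Q).eval β := by field_simp
  rw [e]

lemma X_mul_derivative_rescaledField (Q : ℝ[X]) (n : ℕ) (β : ℝ) :
    X * derivative (rescaledField Q n β) =
      C (1 / (n : ℝ)) * (X * derivative Q).comp (C β * X) := by
  unfold rescaledField
  rw [derivative_C_mul, derivative_comp, mul_comp, X_comp]
  simp
  ring

lemma arcDividedDifference_eval_of_le {W : ℝ[X]} {N : ℕ} (hN : W.natDegree ≤ N) (x : ℝ) :
    (arcDividedDifference W).eval x = ∑ k ∈ Finset.range (N + 1),
      W.coeff k * ∑ i ∈ Finset.range k, arcMoment (k - 1 - i) * x ^ i := by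
  have h1 : (arcDividedDifference W).eval x = ∑ k ∈ Finset.range (W.natDegree + 1),
      W.coeff k * ∑ i ∈ Finset.range k, arcMoment (k - 1 - i) * x ^ i := by
    rw [arcDividedDifference, eval_finsetSum]
    refine Finset.sum_congr rfl fun k _ => ?_
    rw [eval_mul, eval_C, eval_finsetSum, ← Finset.sum_range_reflect]
    congr 1
    refine Finset.sum_congr rfl fun i hi => ?_
    have hi' := Finset.mem_range.1 hi
    have : k - 1 - (k - 1 - i) = i := by omega
    simp [this]
  rw [h1]
  refine Finset.sum_subset (Finset.range_mono (by omega)) fun k _ hk => ?_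
  rw [coeff_eq_zero_of_natDegree_lt (by simpa using hk), zero_mul]

/-- A polynomial whose `k`-th coefficient is an arcsine moment, in decreasing order. -/
noncomputable def momentSum (k : ℕ) (x : ℝ) : ℝ :=
  ∑ i ∈ Finset.range k, arcMoment (k - 1 - i) * x ^ i

lemma momentSum_nonneg (k : ℕ) {x : ℝ} (hx : 0 ≤ x) : 0 ≤ momentSum k x :=
  Finset.sum_nonneg fun i _ => mul_nonneg (arcMoment_pos _).le (pow_nonneg hx i)

/-- Coefficientwise: the moments are at most one and decreasing, so `A_m A_{k-1-i} ≤ A_m ≤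
A_{m-1-i}`. The comparison with the top-degree term is uniform in `x ≥ 0`. -/
lemma mul_momentSum_le {k m : ℕ} (hkm : k ≤ m) {x : ℝ} (hx : 0 ≤ x) :
    arcMoment m * momentSum k x ≤ momentSum m x := by
  unfold momentSum
  rw [Finset.mul_sum]
  calc _ ≤ ∑ i ∈ Finset.range k, arcMoment (m - 1 - i) * x ^ i := by
        refine Finset.sum_le_sum fun i _ => ?_
        rw [← mul_assoc]
        refine mul_le_mul_of_nonneg_right ?_ (pow_nonneg hx i)
        exact (mul_le_of_le_one_right (arcMoment_pos _).le (arcMoment_le_one _)).trans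
          (arcMoment_antitone (by omega))
    _ ≤ _ := Finset.sum_le_sum_of_subset_of_nonneg (Finset.range_mono hkm) fun i _ _ =>
        mul_nonneg (arcMoment_pos _).le (pow_nonneg hx i)

lemma arcMoment_le_momentSum {m : ℕ} (hm : 1 ≤ m) {x : ℝ} (hx : 0 ≤ x) :
    arcMoment m ≤ momentSum m x := by
  have h := mul_momentSum_le hm hx
  have h1 : momentSum 1 x = 1 := by simp [momentSum, arcMoment_zero]
  rwa [h1, mul_one] at h

/-- The value is `(1 / n) ∑ w_k β^k momentSum k x` with `w_k = k q_k`. For large `β` the terms `k <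
m` consume at most half of the top one. What remains is at least `A_m / 2`, because `momentSum m x ≥
A_m` and the MRS equation gives `n ≤ w_m β^m`. -/
theorem arcDividedDifference_lower_bound {Q : ℝ[X]} (hdeg : 1 ≤ Q.natDegree)
    (hlead : 0 < Q.leadingCoeff) : ∃ M : ℝ, ∀ β : ℝ, M < β → ∀ n : ℕ, 1 ≤ n →
      (mrsPolynomial Q).eval β = n → ∀ x : ℝ, 0 ≤ x →
      arcMoment Q.natDegree / 2 ≤
        (arcDividedDifference (X * derivative (rescaledField Q n β))).eval x := by
  set m := Q.natDegree with hm
  set w : ℕ → ℝ := fun k => k * Q.coeff k with hw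
  have hAm := arcMoment_pos m
  have hwm : 0 < w m := by
    have : (0 : ℝ) < m := by exact_mod_cast hdeg
    exact mul_pos this hlead
  set S := ∑ k ∈ Finset.range m, |w k| with hS
  -- `β > 1` gives `β^k ≤ β^(m - 1)` for `k < m`; the second bound gives `S ≤ A_m w_m β / 2`.
  refine ⟨max 1 (2 * S / (arcMoment m * w m)), fun β hβ n hn hmrs x hx => ?_⟩
  have hβ1 : 1 < β := (le_max_left _ _).trans_lt hβ
  have hβ2 : 2 * S / (arcMoment m * w m) < β := (le_max_right _ _).trans_lt hβ
  have hβ0 : 0 < β := by linarith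
  have hn0 : (0 : ℝ) < n := by exact_mod_cast hn
  rw [div_lt_iff₀ (by positivity)] at hβ2
  have hsmall : ∑ k ∈ Finset.range m, |w k| * β ^ k ≤ arcMoment m / 2 * (w m * β ^ m) := by
    calc ∑ k ∈ Finset.range m, |w k| * β ^ k ≤ ∑ k ∈ Finset.range m, |w k| * β ^ (m - 1) := by
          refine Finset.sum_le_sum fun k hk => ?_
          have := Finset.mem_range.1 hk
          exact mul_le_mul_of_nonneg_left (pow_le_pow_right₀ hβ1.le (by omega)) (abs_nonneg _)
      _ = S * β ^ (m - 1) := by rw [hS, Finset.sum_mul]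
      _ ≤ (arcMoment m * w m / 2 * β) * β ^ (m - 1) := by
          refine mul_le_mul_of_nonneg_right ?_ (by positivity)
          linarith
      _ = arcMoment m / 2 * (w m * β ^ m) := by
          have : β ^ m = β ^ (m - 1) * β := by rw [← pow_succ, Nat.sub_add_cancel hdeg]
          rw [this]
          ring
  have hnle : (n : ℝ) ≤ w m * β ^ m := by
    rw [← hmrs, mrsPolynomial, eval_finsetSum, Finset.sum_range_succ]
    simp only [eval_mul, eval_C, eval_pow, eval_X, ← hm]
    have h1 : ∑ k ∈ Finset.range m, 1 / 2 * (k * Q.coeff k * arcMoment k) * β ^ k ≤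
        1 / 2 * ∑ k ∈ Finset.range m, |w k| * β ^ k := by
      rw [Finset.mul_sum]
      refine Finset.sum_le_sum fun k _ => ?_
      have h2 : w k * arcMoment k ≤ |w k| := by
        refine (mul_le_mul_of_nonneg_right (le_abs_self (w k)) (arcMoment_pos k).le).trans ?_
        exact mul_le_of_le_one_right (abs_nonneg _) (arcMoment_le_one k)
      have h3 := mul_le_mul_of_nonneg_right h2 (pow_nonneg hβ0.le k)
      simp only [hw] at h3 ⊢
      linarith
    have h4 : 1 / 2 * (m * Q.coeff m * arcMoment m) * β ^ m ≤ 1 / 2 * (w m * β ^ m) := by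
      have h5 := mul_le_of_le_one_right (show 0 ≤ w m * β ^ m by positivity) (arcMoment_le_one m)
      simp only [hw] at h5 ⊢
      linarith
    have h6 : arcMoment m / 2 * (w m * β ^ m) ≤ w m * β ^ m := by
      refine mul_le_of_le_one_left (by positivity) ?_
      linarith [arcMoment_le_one m]
    linarith
  have hnd : (X * derivative (rescaledField Q n β)).natDegree ≤ m := by
    rw [natDegree_le_iff_coeff_eq_zero]
    intro k hk
    rw [X_mul_derivative_rescaledField, coeff_C_mul, comp_C_mul_X_coeff, coeff_X_mul_derivative,
      coeff_eq_zero_of_natDegree_lt hk]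
    simp
  have heval : (arcDividedDifference (X * derivative (rescaledField Q n β))).eval x =
      1 / n * (∑ k ∈ Finset.range m, w k * β ^ k * momentSum k x +
        w m * β ^ m * momentSum m x) := by
    rw [arcDividedDifference_eval_of_le hnd, ← Finset.sum_range_succ
      (fun k => w k * β ^ k * momentSum k x), Finset.mul_sum]
    refine Finset.sum_congr rfl fun k _ => ?_
    rw [X_mul_derivative_rescaledField, coeff_C_mul, comp_C_mul_X_coeff, coeff_X_mul_derivative]
    simp only [hw, momentSum]
    ring
  have hlow : -(1 / 2 * (w m * β ^ m) * momentSum m x) ≤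
      ∑ k ∈ Finset.range m, w k * β ^ k * momentSum k x := by
    have h1 : -(∑ k ∈ Finset.range m, |w k| * β ^ k * momentSum k x) ≤
        ∑ k ∈ Finset.range m, w k * β ^ k * momentSum k x := by
      rw [← Finset.sum_neg_distrib]
      refine Finset.sum_le_sum fun k _ => ?_
      have := mul_le_mul_of_nonneg_right (neg_abs_le (w k))
        (mul_nonneg (pow_nonneg hβ0.le k) (momentSum_nonneg k hx))
      linarith
    have h2 : arcMoment m * ∑ k ∈ Finset.range m, |w k| * β ^ k * momentSum k x ≤
        (∑ k ∈ Finset.range m, |w k| * β ^ k) * momentSum m x := by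
      rw [Finset.mul_sum, Finset.sum_mul]
      refine Finset.sum_le_sum fun k hk => ?_
      have := mul_le_mul_of_nonneg_left (mul_momentSum_le (Finset.mem_range.1 hk).le hx)
        (mul_nonneg (abs_nonneg (w k)) (pow_nonneg hβ0.le k))
      linarith
    have h3 := mul_le_mul_of_nonneg_right hsmall (momentSum_nonneg m hx)
    have h4 : ∑ k ∈ Finset.range m, |w k| * β ^ k * momentSum k x ≤
        1 / 2 * (w m * β ^ m) * momentSum m x := by
      refine le_of_mul_le_mul_left ?_ hAm
      linarith
    linarith
  rw [heval]
  have hH := arcMoment_le_momentSum hdeg hx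
  have hfin : arcMoment m / 2 * n ≤ ∑ k ∈ Finset.range m, w k * β ^ k * momentSum k x +
        w m * β ^ m * momentSum m x := by
    have h5 : arcMoment m * n ≤ momentSum m x * (w m * β ^ m) :=
      mul_le_mul hH hnle hn0.le (momentSum_nonneg m hx)
    linarith
  rw [one_div, ← div_eq_inv_mul, le_div_iff₀ hn0]
  exact hfin

/-! ### Leading terms, normalization and conclusion -/

lemma natDegree_mrsPolynomial {Q : ℝ[X]} (hdeg : 1 ≤ Q.natDegree) (hlead : 0 < Q.leadingCoeff) :
    (mrsPolynomial Q).natDegree = Q.natDegree ∧ 0 < (mrsPolynomial Q).leadingCoeff := by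
  have hc : 0 < (mrsPolynomial Q).coeff Q.natDegree := by
    rw [coeff_mrsPolynomial, if_pos (Nat.lt_succ_self _)]
    have h1 : (0 : ℝ) < Q.natDegree := by exact_mod_cast hdeg
    have h2 := arcMoment_pos Q.natDegree
    have h3 : 0 < Q.coeff Q.natDegree := hlead
    positivity
  have hn : (mrsPolynomial Q).natDegree = Q.natDegree := by
    refine natDegree_eq_of_le_of_coeff_ne_zero ?_ hc.ne'
    rw [natDegree_le_iff_coeff_eq_zero]
    intro k hk
    rw [coeff_mrsPolynomial, if_neg (by omega)]
  exact ⟨hn, by rwa [leadingCoeff, hn]⟩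

lemma natDegree_rescaledField {Q : ℝ[X]} (hlead : 0 < Q.leadingCoeff) {n : ℕ} (hn : 1 ≤ n) {β : ℝ}
    (hβ : 0 < β) : (rescaledField Q n β).natDegree = Q.natDegree ∧
      0 < (rescaledField Q n β).leadingCoeff := by
  have hn0 : (0 : ℝ) < n := by exact_mod_cast hn
  have h1 : (1 / (n : ℝ)) ≠ 0 := by positivity
  have h2 : (C β * X : ℝ[X]).natDegree = 1 := natDegree_C_mul_X β hβ.ne'
  unfold rescaledField
  constructor
  · rw [natDegree_C_mul h1, natDegree_comp, h2, mul_one]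
  · rw [leadingCoeff_mul, leadingCoeff_C, leadingCoeff_comp (by rw [h2]; exact one_ne_zero),
      leadingCoeff_C_mul_X]
    positivity

/-- The `n` of the MRS equation cancels the `1 / n` of the rescaling. The resulting 2 is what gives
the density mass one. -/
lemma IsMRSNumber.mean_eq_two {Q : ℝ[X]} {n : ℕ} (hn : 1 ≤ n) {β : ℝ} (hβ : IsMRSNumber Q n β) :
    (1 / Real.pi) * ∫ θ in (0 : ℝ)..Real.pi,
      (X * derivative (rescaledField Q n β)).eval (arcPoint θ) = 2 := by
  have hn0 : (n : ℝ) ≠ 0 := by positivity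
  have h1 : ∀ θ : ℝ, (X * derivative (rescaledField Q n β)).eval (arcPoint θ) =
      1 / (n : ℝ) * (X * derivative Q).eval (β * arcPoint θ) := by
    intro θ
    rw [X_mul_derivative_rescaledField, eval_mul, eval_C, eval_comp]
    simp only [eval_mul, eval_C, eval_X]
  simp_rw [h1]
  rw [intervalIntegral.integral_const_mul, integral_X_mul_derivative_eval,
    ((isMRSNumber_iff Q n β).1 hβ).2]
  have := Real.pi_pos.ne'
  field_simp

theorem proposition3p4 (Q : Polynomial ℝ) (hdeg : 1 ≤ Q.natDegree) (hlead : 0 < Q.leadingCoeff) :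
    (∃ n₂ : ℕ, ∃ h₀ : ℝ, 0 < h₀ ∧ ∀ n : ℕ, n₂ ≤ n →
      (∃! β : ℝ, IsMRSNumber Q n β) ∧
      ∀ β : ℝ, IsMRSNumber Q n β →
        ∃ h : Polynomial ℝ, IsDensityPolynomial (rescaledField Q n β) h ∧
          ∀ x : ℝ, 0 ≤ x → h₀ < h.eval x) ∧
    (∀ n : ℕ, 1 ≤ n → ∀ β : ℝ, IsMRSNumber Q n β →
      ∀ h : Polynomial ℝ, IsDensityPolynomial (rescaledField Q n β) h →
      (∀ x : ℝ, 0 ≤ x → 0 < h.eval x) →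
        (∀ x : ℝ, 0 ≤ equilibriumDensity h x) ∧
        MeasureTheory.Integrable (equilibriumDensity h) ∧
        (∫ y in (0 : ℝ)..1, equilibriumDensity h y) = 1 ∧
        (∀ x : ℝ, 0 ≤ x →
          MeasureTheory.Integrable fun y : ℝ => Real.log |x - y| * equilibriumDensity h y) ∧
        (∃ ℓ : ℝ,
          (∀ x ∈ Set.Icc (0 : ℝ) 1,
            2 * (∫ y : ℝ, Real.log |x - y| * equilibriumDensity h y)
              - (rescaledField Q n β).eval x - ℓ = 0) ∧
          (∀ x ∈ Set.Ioi (1 : ℝ),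
            2 * (∫ y : ℝ, Real.log |x - y| * equilibriumDensity h y)
              - (rescaledField Q n β).eval x - ℓ < 0)) ∧
        IsEquilibriumMeasure (Set.Ici 0) (fun x => (rescaledField Q n β).eval x)
          (MeasureTheory.volume.withDensity fun x => ENNReal.ofReal (equilibriumDensity h x))) := by
  constructor
  · obtain ⟨hd, hl⟩ := natDegree_mrsPolynomial hdeg hlead
    obtain ⟨M, hM⟩ := arcDividedDifference_lower_bound hdeg hlead
    obtain ⟨N, hN⟩ := exists_unique_pos_eval_eq (hd.symm ▸ hdeg) hl M
    have hA := arcMoment_pos Q.natDegree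
    -- The index exceeds `N` and is nonzero; the lower bound `A_m / 2` is halved to make the
    -- inequality strict.
    refine ⟨max 1 (⌈N⌉₊ + 1), arcMoment Q.natDegree / 4, by linarith, fun n hn => ?_⟩
    have hn1 : 1 ≤ n := (le_max_left _ _).trans hn
    have hnN : N < n := by
      have h1 : ⌈N⌉₊ + 1 ≤ n := (le_max_right _ _).trans hn
      have h2 : ((⌈N⌉₊ + 1 : ℕ) : ℝ) ≤ n := by exact_mod_cast h1
      push_cast at h2
      linarith [Nat.le_ceil N]
    obtain ⟨huniq, hlarge⟩ := hN n hnN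
    simp_rw [isMRSNumber_iff]
    refine ⟨huniq, fun β hβ => ⟨_, isDensityPolynomial_arcDividedDifference _, fun x hx => ?_⟩⟩
    have := hM β (hlarge β hβ.1 hβ.2) n hn1 hβ.2 x hx
    linarith
  · intro n hn β hβ h hh hpos
    obtain ⟨hd, hl⟩ := natDegree_rescaledField hlead hn hβ.1
    obtain ⟨s, b, hV⟩ := exists_eq_sum_shiftedT (rescaledField Q n β)
    have hrel := sub_one_mul_arcDividedDifference hV
    rw [hβ.mean_eq_two hn, ← hh.eq_arcDividedDifference] at hrel
    refine ⟨equilibriumDensity_nonneg hpos, integrable_equilibriumDensity h, ?_,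
      fun x hx => integrable_log_mul_equilibriumDensity h hx,
      ⟨_, fun x hx => potential_eq_on_Icc hV hrel hx,
        fun x hx => potential_lt_on_Ioi hV hrel hpos hx⟩,
      isEquilibriumMeasure_withDensity (hd.symm ▸ hdeg) hl hV hrel hpos⟩
    -- The density vanishes off `(0, 1]`, so its integral over `[0, 1]` is the integral over the
    -- line.
    refine Eq.trans ?_ (integral_equilibriumDensity hrel)
    rw [intervalIntegral.integral_of_le zero_le_one, ← integral_indicator measurableSet_Ioc]
    refine integral_congr_ae (Filter.Eventually.of_forall fun x => ?_)
    by_cases hx : x ∈ Set.Ioc (0 : ℝ) 1 <;>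
      simp only [equilibriumDensity, Set.indicator_of_mem, Set.indicator_of_notMem, hx,
        not_false_eq_true]
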